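/- **Theorem 2.5.** Let $K$ be a field of characteristic zero or $K=\mathbb Z$, and let $n,m\ge 0$. Let $\Sigma=(\mathbf x,\mathbf y,B)$ be a seed over $K$: $\mathbf x=(x_1,\dots,x_n)$ (exchangeable variables) and $\mathbf y=(x_{n+1},\dots,x_{n+m})$ (frozen variables) are such that $x_1,\dots,x_{n+m}$ are algebraically independent over $K$, with ambient field $\mathcal F=\operatorname{Frac}(K)(x_1,\dots,x_{n+m})$, and $B=(b_{ij})$ is an $(n+m)\times n$ integer matrix for which there are positive integers $d_1,\dots,d_n$ with $d_ib_{ij}=-d_jb_{ji}$ for all $1\le i,j\le n$. For $1\le i\le n$, the mutation of $\Sigma$ in direction $i$ leaves all variables unchanged except that it replaces $x_i$ by $$x_i'=\frac1{x_i}\Bigl(\prod_{b_{ki}>0}x_k^{b_{ki}}+\prod_{b_{ki}<0}x_k^{-b_{ki}}\Bigr)\in\mathcal F,$$ and it replaces $B$ by the matrix $(b'_{jk})$ with $b'_{jk}=-b_{jk}$ if $j=i$ or $k=i$, and $b'_{jk}=b_{jk}+\tfrac12\bigl(|b_{ji}|b_{ik}+b_{ji}|b_{ik}|\bigr)$ otherwise.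 Two seeds are mutation-equivalent if one is obtained from the other by a finite (possibly empty) sequence of mutations. Let $\mathcal X$ be the set of all exchangeable variables of all seeds mutation-equivalent to $\Sigma$. The cluster algebra and the upper cluster algebra of $\Sigma$ (of geometric type, with invertible frozen variables) are the $K$-subalgebras of $\mathcal F$ $$\mathcal A=K[x,\,y^{\pm1}\mid x\in\mathcal X,\ y\in\{x_{n+1},\dots,x_{n+m}\}],\qquad \mathcal U=\bigcap_{(\mathbf z,\mathbf y,C)\sim\Sigma}K[u^{\pm1}\mid u\in\mathbf z\cup\mathbf y].$$ Then $\mathcal A$ and $\mathcal U$ are finite factorization domains (FF-domains): they are domains in which every nonzero non-unit is a finite product of atoms (irreducible elements) and has only finitely many factorizations into atoms up to order and associates. In particular, $\mathcal A$ and $\mathcal U$ are BF-domains (every nonzero non-unit is a finite product of atoms, and the number of factors in its factorizations into atoms is bounded) and atomic (every nonzero non-unit is a finite product of atoms). -/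

import Mathlib

/-! ### Factorization in domains

For a domain `A` the relevant monoid is the cancellative monoid of nonzero elements of `A`.  Its atoms
are the irreducible elements of `A`, and its units are the units of `A`. -/

/-- `s` is a factorization of `a` into atoms. -/
def IsAtomFactorization {A : Type*} [CommRing A] (s : Multiset A) (a : A) : Prop :=
  (∀ u ∈ s, Irreducible u) ∧ s.prod = a

/-- An atomic domain: every nonzero non-unit is a finite product of atoms. -/
structure IsAtomicDomain (A : Type*) [CommRing A] : Prop where
  isDomain : IsDomain A
  exists_factorization : ∀ a : A, a ≠ 0 → ¬ IsUnit a → ∃ s : Multiset A, IsAtomFactorization s a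

/-- A bounded factorization domain: atomic, and the lengths of the factorizations of a given nonzero
non-unit into atoms are bounded. -/
structure IsBFDomain (A : Type*) [CommRing A] : Prop where
  isAtomicDomain : IsAtomicDomain A
  bounded_length : ∀ a : A, a ≠ 0 → ¬ IsUnit a →
    ∃ N : ℕ, ∀ s : Multiset A, IsAtomFactorization s a → Multiset.card s ≤ N

/-- A finite factorization domain: atomic, and every nonzero non-unit has only finitely many
factorizations into atoms up to order (multisets) and associates (classes in `Associates A`). -/
structure IsFFDomain (A : Type*) [CommRing A] : Prop where
  isAtomicDomain : IsAtomicDomain A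
  finite_factorizations : ∀ a : A, a ≠ 0 → ¬ IsUnit a →
    {t : Multiset (Associates A) |
      ∃ s : Multiset A, IsAtomFactorization s a ∧ s.map Associates.mk = t}.Finite

/-! ### Ground rings, exchange matrices and seeds -/

/-- The admissible ground rings: fields of characteristic zero and the ring of integers. -/
def IsClusterGroundRing (K : Type*) [CommRing K] : Prop :=
  (IsField K ∧ CharZero K) ∨ Nonempty (K ≃+* ℤ)

/-- An exchange matrix: an integer matrix whose rows are indexed by the exchangeable indices `ι` and the
frozen indices `κ`, whose columns are indexed by `ι`, and whose principal part is skew-symmetrizable. -/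
def IsExchangeMatrix {ι κ : Type*} (B : Matrix (ι ⊕ κ) ι ℤ) : Prop :=
  ∃ d : ι → ℕ, (∀ i, 0 < d i) ∧
    ∀ i j, (d i : ℤ) * B (Sum.inl i) j = -((d j : ℤ) * B (Sum.inl j) i)

/-- The data of a labelled seed in the field `F`: exchangeable variables `var (Sum.inl i)`, frozen
variables `var (Sum.inr k)`, and an integer matrix. -/
structure SeedData (F ι κ : Type*) where
  var : ι ⊕ κ → F
  B : Matrix (ι ⊕ κ) ι ℤ

namespace SeedData

variable {F ι κ : Type*} [Field F]

/-- The data `S` form a seed over `K` with ambient field `F`: the variables are algebraically independent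
over `K`, the field `F` is the field of rational functions in them over the fraction field of `K`, and
the matrix is an exchange matrix. -/
structure IsSeed (K : Type*) [CommRing K] [Algebra K F] (S : SeedData F ι κ) : Prop where
  algebraicIndependent : AlgebraicIndependent K S.var
  ambient : Subfield.closure (Set.range (algebraMap K F) ∪ Set.range S.var) = ⊤
  isExchangeMatrix : IsExchangeMatrix S.B

/-- The exchange polynomial at the exchangeable index `i`, evaluated at the variables of `S`:
`∏_{b_{ki} > 0} x_k ^ b_{ki} + ∏_{b_{ki} < 0} x_k ^ (-b_{ki})`.  The factors with the wrong sign have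
exponent `0`, since `Int.toNat` vanishes on nonpositive integers. -/
def exchange [Fintype ι] [Fintype κ] (S : SeedData F ι κ) (i : ι) : F :=
  (∏ k, S.var k ^ (S.B k i).toNat) + ∏ k, S.var k ^ (-(S.B k i)).toNat

/-- Mutation of a matrix in direction `i`.  The integer that is divided by `2` is always even. -/
def mutateMatrix [DecidableEq ι] [DecidableEq κ] (B : Matrix (ι ⊕ κ) ι ℤ) (i : ι) :
    Matrix (ι ⊕ κ) ι ℤ :=
  fun j k =>
    if j = Sum.inl i ∨ k = i then -(B j k)
    else B j k + (|B j i| * B (Sum.inl i) k + B j i * |B (Sum.inl i) k|) / 2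

/-- Mutation of a seed in the exchangeable direction `i`. -/
noncomputable def mutate [Fintype ι] [Fintype κ] [DecidableEq ι] [DecidableEq κ]
    (S : SeedData F ι κ) (i : ι) : SeedData F ι κ where
  var := Function.update S.var (Sum.inl i) ((S.var (Sum.inl i))⁻¹ * S.exchange i)
  B := mutateMatrix S.B i

/-- `S.MutationEquiv T`: the seed `T` is obtained from `S` by a finite sequence of mutations. -/
inductive MutationEquiv [Fintype ι] [Fintype κ] [DecidableEq ι] [DecidableEq κ]
    (S : SeedData F ι κ) : SeedData F ι κ → Prop
  | refl : MutationEquiv S S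
  | mutate (T : SeedData F ι κ) (i : ι) : MutationEquiv S T → MutationEquiv S (T.mutate i)

/-- The set of cluster variables: all exchangeable variables of all seeds mutation-equivalent to `S`. -/
def clusterVariables [Fintype ι] [Fintype κ] [DecidableEq ι] [DecidableEq κ]
    (S : SeedData F ι κ) : Set F :=
  {x | ∃ T : SeedData F ι κ, S.MutationEquiv T ∧ ∃ i : ι, T.var (Sum.inl i) = x}

/-- The cluster algebra of `S` over `K`, with invertible frozen variables, inside the ambient field. -/
def clusterAlgebra (K : Type*) [CommRing K] [Algebra K F]
    [Fintype ι] [Fintype κ] [DecidableEq ι] [DecidableEq κ] (S : SeedData F ι κ) : Subalgebra K F :=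
  Algebra.adjoin K
    (S.clusterVariables ∪ Set.range (fun k : κ => S.var (Sum.inr k)) ∪
      Set.range (fun k : κ => (S.var (Sum.inr k))⁻¹))

/-- The ring of Laurent polynomials over `K` in all variables (exchangeable and frozen) of `S`. -/
def laurentRing (K : Type*) [CommRing K] [Algebra K F] (S : SeedData F ι κ) : Subalgebra K F :=
  Algebra.adjoin K (Set.range S.var ∪ Set.range (fun k : ι ⊕ κ => (S.var k)⁻¹))

/-- The upper cluster algebra of `S` over `K`: the intersection of the Laurent polynomial rings of all
seeds mutation-equivalent to `S`. -/
def upperClusterAlgebra (K : Type*) [CommRing K] [Algebra K F]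
    [Fintype ι] [Fintype κ] [DecidableEq ι] [DecidableEq κ] (S : SeedData F ι κ) : Subalgebra K F :=
  ⨅ (T : SeedData F ι κ) (_ : S.MutationEquiv T), T.laurentRing K

end SeedData

/-!
The argument has two halves: the Laurent phenomenon, and a finiteness statement for divisors inside
Laurent polynomial rings.

Write `L(T)` for the Laurent ring of a seed `T`, and call `U(T) = L(T) ∩ ⋂ i, L(μ_i T)` its upper bound.

*Laurent phenomenon.* If the columns of the exchange matrix are linearly independent, then `U(T)` does not
change under mutation (`SeedData.upperBound_mutate`), so all cluster variables lie in `L(T)`. The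
invariance is a rank two statement: `L(T) ∩ L(μ_i T) ∩ L(μ_j T)` is contained in `L(μ_j μ_i T)`. When
`b_ji ≠ 0`, an element of the left-hand side acquires in `L(μ_j μ_i T)` only powers of two comaximal
exchange polynomials as denominators (`SeedData.mem_laurentRing_mutate_mutate_of_pos`). When `b_ji = 0`
the two exchange polynomials are relatively prime because their columns are independent
(`isRelPrime_exchangePolynomial`). An arbitrary seed is reduced to one with independent columns by adding
principal coefficients and then setting the additional frozen variables to `1`
(`SeedData.MutationEquiv.var_mem_laurentRing`). Consequently the cluster algebra is contained in the upper
cluster algebra, which is contained in `U(S)`.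

*Finiteness.* Let `D` be either algebra and let `a ∈ D` be nonzero. In `L(S)` a divisor of `a` is a Laurent
monomial times one of finitely many polynomials, up to units of the ground ring. To bound the exponent
of an exchangeable variable `x_i` in this monomial, look at the Laurent ring of the seed mutated at `i`: up
to a unit, `x_i` is there the exchange polynomial `P`. If `P` is not a unit, only boundedly many powers of
it divide a given nonzero element, since that ring is noetherian (`SeedData.exists_bound_exponent`). If `P`
is a unit, then `P = 2` with `2` invertible in the ground ring, and `x_i` is a unit of `D`
(`SeedData.inv_exchange_notMem_or_inv_var_mem`). So `a` has finitely many divisors up to associates, and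
this implies finite factorization (`isFFDomain_of_finite_divisors`).
-/

open MvPolynomial

/-! ### Laurent polynomials in a family of elements of a field -/

section Laurent

variable {K F σ : Type*} [CommRing K] [Field F] [Algebra K F]

/-- The `K`-subalgebra of `F` generated by the elements `x k` and their inverses. -/
def laurentSubalgebra (K : Type*) [CommRing K] [Algebra K F] (x : σ → F) : Subalgebra K F :=
  Algebra.adjoin K (Set.range x ∪ Set.range fun k => (x k)⁻¹)

theorem mem_laurentSubalgebra (x : σ → F) (k : σ) : x k ∈ laurentSubalgebra K x :=
  Algebra.subset_adjoin (Or.inl ⟨k, rfl⟩)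

theorem inv_mem_laurentSubalgebra (x : σ → F) (k : σ) : (x k)⁻¹ ∈ laurentSubalgebra K x :=
  Algebra.subset_adjoin (Or.inr ⟨k, rfl⟩)

theorem laurentSubalgebra_le_iff {x : σ → F} {A : Subalgebra K F} :
    laurentSubalgebra K x ≤ A ↔ ∀ k, x k ∈ A ∧ (x k)⁻¹ ∈ A := by
  constructor
  · exact fun h k => ⟨h (mem_laurentSubalgebra x k), h (inv_mem_laurentSubalgebra x k)⟩
  · intro h
    refine Algebra.adjoin_le ?_
    rintro _ (⟨k, rfl⟩ | ⟨k, rfl⟩)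
    exacts [(h k).1, (h k).2]

theorem aeval_mem_laurentSubalgebra (x : σ → F) (f : MvPolynomial σ K) :
    aeval x f ∈ laurentSubalgebra K x := by
  induction f using MvPolynomial.induction_on with
  | C a => simp
  | add p q hp hq => rw [map_add]; exact add_mem hp hq
  | mul_X p k hp => simpa using mul_mem hp (mem_laurentSubalgebra x k)

theorem aeval_monomial_one (x : σ → F) (d : σ →₀ ℕ) :
    aeval x (monomial d (1 : K)) = d.prod fun k n => x k ^ n := by
  simp [aeval_monomial]

theorem aeval_monomial_ne_zero {x : σ → F} (hx : ∀ k, x k ≠ 0) (d : σ →₀ ℕ) :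
    aeval x (monomial d (1 : K)) ≠ 0 := by
  rw [aeval_monomial_one]
  exact Finset.prod_ne_zero_iff.mpr fun k _ => pow_ne_zero _ (hx k)

theorem inv_aeval_monomial_mem_laurentSubalgebra (x : σ → F) (d : σ →₀ ℕ) :
    (aeval x (monomial d (1 : K)))⁻¹ ∈ laurentSubalgebra K x := by
  rw [aeval_monomial_one, Finsupp.prod, ← Finset.prod_inv_distrib]
  refine prod_mem fun k _ => ?_
  rw [← inv_pow]
  exact pow_mem (inv_mem_laurentSubalgebra x k) _

/-- Laurent polynomials are the fractions with polynomial numerator and monomial denominator. -/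
theorem mem_laurentSubalgebra_iff {x : σ → F} (hx : ∀ k, x k ≠ 0) {z : F} :
    z ∈ laurentSubalgebra K x ↔ ∃ (d : σ →₀ ℕ) (f : MvPolynomial σ K),
      z * aeval x (monomial d (1 : K)) = aeval x f := by
  constructor
  · intro hz
    have hadd (d e : σ →₀ ℕ) : aeval x (monomial (d + e) (1 : K)) =
        aeval x (monomial d (1 : K)) * aeval x (monomial e (1 : K)) := by
      rw [← map_mul, monomial_mul, one_mul]
    induction hz using Algebra.adjoin_induction with
    | mem z hz =>
      rcases hz with ⟨k, rfl⟩ | ⟨k, rfl⟩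
      · exact ⟨0, X k, by simp⟩
      · exact ⟨Finsupp.single k 1, 1, by simp [aeval_monomial, hx k]⟩
    | algebraMap r => exact ⟨0, C r, by simp⟩
    | add a b _ _ ha hb =>
      obtain ⟨d, f, hf⟩ := ha
      obtain ⟨e, g, hg⟩ := hb
      refine ⟨d + e, f * monomial e 1 + g * monomial d 1, ?_⟩
      rw [hadd, map_add, map_mul, map_mul, ← hf, ← hg]
      ring
    | mul a b _ _ ha hb =>
      obtain ⟨d, f, hf⟩ := ha
      obtain ⟨e, g, hg⟩ := hb
      refine ⟨d + e, f * g, ?_⟩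
      rw [hadd, map_mul, ← hf, ← hg]
      ring
  · rintro ⟨d, f, hf⟩
    rw [eq_mul_inv_iff_mul_eq₀ (aeval_monomial_ne_zero hx d) |>.2 hf]
    exact mul_mem (aeval_mem_laurentSubalgebra x f) (inv_aeval_monomial_mem_laurentSubalgebra x d)

/-- A divisor of a Laurent polynomial `f / x ^ d` is, up to a Laurent monomial, a divisor of the
polynomial `f`. -/
theorem exists_dvd_of_mul_eq [IsDomain K] {x : σ → F} (hx : AlgebraicIndependent K x)
    {a b c : F} (hb : b ∈ laurentSubalgebra K x) (hc : c ∈ laurentSubalgebra K x)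
    (habc : b * c = a) {d : σ →₀ ℕ} {f : MvPolynomial σ K}
    (hf : a * aeval x (monomial d (1 : K)) = aeval x f) :
    ∃ (m n : σ →₀ ℕ) (g : MvPolynomial σ K), g ∣ f ∧
      b * aeval x (monomial n (1 : K)) = aeval x (monomial m (1 : K)) * aeval x g := by
  have hx0 : ∀ k, x k ≠ 0 := hx.ne_zero
  obtain ⟨n, B, hB⟩ := (mem_laurentSubalgebra_iff hx0).1 hb
  obtain ⟨n', C, hC⟩ := (mem_laurentSubalgebra_iff hx0).1 hc
  have key : B * (C * monomial d 1) = monomial (n + n') 1 * f := by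
    apply hx
    have : aeval x (monomial (n + n') (1 : K)) =
        aeval x (monomial n (1 : K)) * aeval x (monomial n' (1 : K)) := by
      rw [← map_mul, monomial_mul, one_mul]
    rw [map_mul, map_mul, map_mul, ← hB, ← hC, ← hf, this, ← habc]
    ring
  obtain ⟨m, g, -, hg, rfl⟩ := dvd_monomial_mul_iff_exists.1 (Dvd.intro _ key)
  exact ⟨m, n, g, hg, by rw [hB, map_mul]⟩

/-- The elements of `F` that are multiplied into `A` by a power of `p`. -/
def Subalgebra.locAway (A : Subalgebra K F) (p : F) (hp : p ∈ A) : Subalgebra K F where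
  carrier := {z | ∃ N : ℕ, p ^ N * z ∈ A}
  mul_mem' := by
    rintro a b ⟨M, ha⟩ ⟨N, hb⟩
    refine ⟨M + N, ?_⟩
    rw [show p ^ (M + N) * (a * b) = (p ^ M * a) * (p ^ N * b) by ring]
    exact mul_mem ha hb
  add_mem' := by
    rintro a b ⟨M, ha⟩ ⟨N, hb⟩
    refine ⟨M + N, ?_⟩
    rw [show p ^ (M + N) * (a + b) = p ^ N * (p ^ M * a) + p ^ M * (p ^ N * b) by ring]
    exact add_mem (mul_mem (pow_mem hp _) ha) (mul_mem (pow_mem hp _) hb)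
  algebraMap_mem' r := ⟨0, by simp⟩

theorem Subalgebra.le_locAway {A : Subalgebra K F} {p : F} (hp : p ∈ A) : A ≤ A.locAway p hp :=
  fun z hz => ⟨0, by simpa using hz⟩

/-- Comaximal denominators cancel. -/
theorem Subalgebra.mem_of_mem_locAway {A : Subalgebra K F} {p q : F} {hp : p ∈ A} {hq : q ∈ A}
    (hpq : ∃ a ∈ A, ∃ b ∈ A, a * p + b * q = 1) {z : F} (hzp : z ∈ A.locAway p hp)
    (hzq : z ∈ A.locAway q hq) : z ∈ A := by
  obtain ⟨M, hM⟩ := hzp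
  obtain ⟨N, hN⟩ := hzq
  obtain ⟨a, ha, b, hb, hab⟩ := hpq
  have hco : IsCoprime (⟨p, hp⟩ : A) ⟨q, hq⟩ := ⟨⟨a, ha⟩, ⟨b, hb⟩, Subtype.ext hab⟩
  obtain ⟨u, v, huv⟩ := hco.pow (m := M) (n := N)
  have huv' : (u : F) * p ^ M + v * q ^ N = 1 := by simpa using congrArg Subtype.val huv
  have : z = u * (p ^ M * z) + v * (q ^ N * z) := by linear_combination (-z) * huv'
  rw [this]
  exact add_mem (mul_mem u.2 hM) (mul_mem v.2 hN)

theorem pow_toNat_of_nonneg (x : F) {n : ℤ} (hn : 0 ≤ n) : x ^ n.toNat = x ^ n := by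
  rw [← zpow_natCast, Int.toNat_of_nonneg hn]

/-- Linear independence of the integral powers of a transcendental element. -/
theorem eq_zero_of_sum_mul_zpow_eq_zero {A : Subalgebra K F} {t : F} (ht : Transcendental A t)
    (s : Finset ℤ) (c : ℤ → F) (hc : ∀ k ∈ s, c k ∈ A) (h : ∑ k ∈ s, c k * t ^ k = 0) :
    ∀ k ∈ s, c k = 0 := by
  have ht0 : t ≠ 0 := by
    rintro rfl
    exact ht isAlgebraic_zero
  set N : ℤ := ∑ k ∈ s, |k|
  have hN : ∀ k ∈ s, 0 ≤ k + N := fun k hk => by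
    have : |k| ≤ N := Finset.single_le_sum (f := fun k : ℤ => |k|) (fun k _ => abs_nonneg k) hk
    have := neg_abs_le k
    omega
  let p : Polynomial A := ∑ k ∈ s.attach,
    Polynomial.monomial (k.1 + N).toNat (⟨c k, hc k k.2⟩ : A)
  have hp : p = 0 := by
    by_contra hp0
    refine ht ⟨p, hp0, ?_⟩
    have h1 : Polynomial.aeval t p = ∑ k ∈ s, c k * t ^ (k + N).toNat := by
      rw [← Finset.sum_attach s, map_sum]
      exact Finset.sum_congr rfl fun k _ => by rw [Polynomial.aeval_monomial]; rfl
    have h2 : ∑ k ∈ s, c k * t ^ (k + N).toNat = (∑ k ∈ s, c k * t ^ k) * t ^ N := by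
      rw [Finset.sum_mul]
      refine Finset.sum_congr rfl fun k hk => ?_
      rw [pow_toNat_of_nonneg _ (hN k hk), zpow_add₀ ht0, mul_assoc]
    rw [h1, h2, h, zero_mul]
  intro k hk
  have hcoeff := congrArg (fun q => ((q.coeff (k + N).toNat : A) : F)) hp
  simp only [p, Polynomial.finsetSum_coeff, Polynomial.coeff_monomial,
    Polynomial.coeff_zero] at hcoeff
  rw [Finset.sum_eq_single (⟨k, hk⟩ : {k // k ∈ s})] at hcoeff
  · simpa using hcoeff
  · rintro ⟨j, hj⟩ - hne
    rw [if_neg]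
    intro hjk
    apply hne
    have := hN k hk
    have := hN j hj
    change (j + N).toNat = (k + N).toNat at hjk
    exact Subtype.ext (by omega : j = k)
  · intro hk'
    exact absurd (Finset.mem_attach _ _) hk'

/-- The subalgebra generated by the `x j` and their inverses for `j ≠ i`. -/
def laurentSubalgebraCompl (K : Type*) [CommRing K] [Algebra K F] (x : σ → F) (i : σ) :
    Subalgebra K F :=
  laurentSubalgebra K fun j : {j // j ≠ i} => x j

theorem mem_laurentSubalgebraCompl (x : σ → F) {i k : σ} (hk : k ≠ i) :
    x k ∈ laurentSubalgebraCompl K x i :=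
  mem_laurentSubalgebra (K := K) (fun j : {j // j ≠ i} => x j) ⟨k, hk⟩

theorem inv_mem_laurentSubalgebraCompl (x : σ → F) {i k : σ} (hk : k ≠ i) :
    (x k)⁻¹ ∈ laurentSubalgebraCompl K x i :=
  inv_mem_laurentSubalgebra (K := K) (fun j : {j // j ≠ i} => x j) ⟨k, hk⟩

/-- The elements algebraic over the polynomial ring in the variables other than `x i` form a subalgebra
closed under inverses, over which `x i` is still transcendental. Replacing `x i` by any other element
transcendental over this subalgebra preserves algebraic independence. -/
theorem exists_subalgebra_transcendental [DecidableEq σ] [Nontrivial K]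
    {x : σ → F} (hx : AlgebraicIndependent K x) (i : σ) :
    ∃ E : Subalgebra K F, (∀ z ∈ E, z⁻¹ ∈ E) ∧ laurentSubalgebraCompl K x i ≤ E ∧
      Transcendental E (x i) ∧
      ∀ t : F, Transcendental E t → AlgebraicIndependent K (Function.update x i t) := by
  set A := Algebra.adjoin K (x '' {i}ᶜ)
  have hA := (AlgebraicIndependent.iff_transcendental_adjoin_image i).1 hx
  set E' : Subalgebra A F := Subalgebra.algebraicClosure A F
  have hinv : ∀ z ∈ E', z⁻¹ ∈ E' := fun z hz => IsAlgebraic.inv hz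
  have hAE : ∀ z ∈ A, z ∈ E' := fun z hz => E'.algebraMap_mem ⟨z, hz⟩
  refine ⟨E'.restrictScalars K, hinv, ?_, hA.2.subalgebraAlgebraicClosure, ?_⟩
  · refine laurentSubalgebra_le_iff.2 fun k => ?_
    have hk : x k ∈ E' := hAE _ (Algebra.subset_adjoin ⟨k, k.2, rfl⟩)
    exact ⟨hk, hinv _ hk⟩
  · intro t ht
    refine (AlgebraicIndependent.iff_transcendental_adjoin_image i).2 ⟨?_, ?_⟩
    · convert hA.1 using 2 with j
      exact Function.update_of_ne j.2 _ _
    · have him : Function.update x i t '' {i}ᶜ = x '' {i}ᶜ :=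
        Set.image_congr fun j hj => Function.update_of_ne hj _ _
      rw [Function.update_self, him]
      intro hAt
      exact (ht : Transcendental E' t) (isAlgebraic_algebraMap (⟨t, hAt⟩ : E'))

theorem exists_finsupp_of_mem_laurentSubalgebra {x : σ → F} {i : σ} (hi : x i ≠ 0) {z : F}
    (hz : z ∈ laurentSubalgebra K x) :
    ∃ c : ℤ →₀ F, (∀ k, c k ∈ laurentSubalgebraCompl K x i) ∧ z = c.sum fun k a => a * x i ^ k := by
  classical
  set A := laurentSubalgebraCompl K x i
  let φ : LaurentPolynomial A →+* F :=
    LaurentPolynomial.eval₂ (algebraMap A F) (Units.mk0 (x i) hi)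
  have hφ : ∃ f, φ f = z := by
    induction hz using Algebra.adjoin_induction with
    | mem z hz =>
      rcases hz with ⟨k, rfl⟩ | ⟨k, rfl⟩
      · by_cases hk : k = i
        · subst hk
          exact ⟨LaurentPolynomial.T 1, by simp [φ]⟩
        · exact ⟨LaurentPolynomial.C ⟨x k, mem_laurentSubalgebraCompl x hk⟩,
            LaurentPolynomial.eval₂_C _ _ _⟩
      · by_cases hk : k = i
        · subst hk
          exact ⟨LaurentPolynomial.T (-1), by simp [φ]⟩
        · exact ⟨LaurentPolynomial.C ⟨(x k)⁻¹, inv_mem_laurentSubalgebraCompl x hk⟩,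
            LaurentPolynomial.eval₂_C _ _ _⟩
    | algebraMap r => 
      exact ⟨LaurentPolynomial.C (algebraMap K A r), LaurentPolynomial.eval₂_C _ _ _⟩
    | add a b _ _ ha hb =>
      obtain ⟨f, rfl⟩ := ha
      obtain ⟨g, rfl⟩ := hb
      exact ⟨f + g, map_add φ f g⟩
    | mul a b _ _ ha hb =>
      obtain ⟨f, rfl⟩ := ha
      obtain ⟨g, rfl⟩ := hb
      exact ⟨f * g, map_mul φ f g⟩
  clear hz
  obtain ⟨f, rfl⟩ := hφ
  induction f using LaurentPolynomial.induction_on' with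
  | add p q hp hq =>
    obtain ⟨c, hc, hpc⟩ := hp
    obtain ⟨d, hd, hqd⟩ := hq
    refine ⟨c + d, fun k => add_mem (hc k) (hd k), ?_⟩
    rw [map_add, hpc, hqd, Finsupp.sum_add_index' (by simp) (by simp [add_mul])]
  | C_mul_T n a =>
    refine ⟨Finsupp.single n a, fun k => ?_, ?_⟩
    · rw [Finsupp.single_apply]
      split_ifs
      exacts [a.2, zero_mem _]
    · rw [Finsupp.sum_single_index (by simp)]
      simp only [φ, LaurentPolynomial.eval₂_C_mul_T, Units.val_zpow_eq_zpow_val, Units.val_mk0]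
      rfl

/-- Elements that are Laurent polynomials both in `x` and in the family in which `x i` is replaced by
`p / x i`, where `p` is a Laurent polynomial in the other variables, are polynomials in `x i` and
`p / x i` over the Laurent polynomials in the other variables: comparing the coefficients of the powers
of `x i`, the coefficient of `(x i) ^ (-k)` is divisible by `p ^ k`. -/
theorem mem_of_mem_laurentSubalgebra_of_mem_update [DecidableEq σ] [Nontrivial K] {x : σ → F}
    (hx : AlgebraicIndependent K x) (i : σ) {p : F} (hp : p ∈ laurentSubalgebraCompl K x i)
    (hp0 : p ≠ 0) {z : F} (hz : z ∈ laurentSubalgebra K x)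
    (hz' : z ∈ laurentSubalgebra K (Function.update x i ((x i)⁻¹ * p)))
    {A : Subalgebra K F} (hA : laurentSubalgebraCompl K x i ≤ A) (hxA : x i ∈ A)
    (hxA' : (x i)⁻¹ * p ∈ A) : z ∈ A := by
  have hi : x i ≠ 0 := hx.ne_zero i
  obtain ⟨E, hEinv, hE, htr, -⟩ := exists_subalgebra_transcendental hx i
  have hcompl : laurentSubalgebraCompl K (Function.update x i ((x i)⁻¹ * p)) i =
      laurentSubalgebraCompl K x i := by
    unfold laurentSubalgebraCompl
    congr 1
    funext j
    exact Function.update_of_ne j.2 _ _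
  obtain ⟨c, hc, hzc⟩ := exists_finsupp_of_mem_laurentSubalgebra (i := i) hi hz
  obtain ⟨d, hd, hzd⟩ := exists_finsupp_of_mem_laurentSubalgebra (i := i)
    (by rw [Function.update_self]; exact mul_ne_zero (inv_ne_zero hi) hp0) hz'
  rw [hcompl] at hd
  rw [Function.update_self] at hzd
  set s : Finset ℤ := c.support ∪ d.support.map (Equiv.neg ℤ).toEmbedding
  have hcs : z = ∑ k ∈ s, c k * x i ^ k := by
    rw [hzc, Finsupp.sum]
    refine Finset.sum_subset Finset.subset_union_left fun k _ hk => ?_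
    rw [Finsupp.notMem_support_iff.1 hk, zero_mul]
  have hds : z = ∑ k ∈ s, d (-k) * p ^ (-k) * x i ^ k := by
    have h1 : z = ∑ k ∈ d.support.map (Equiv.neg ℤ).toEmbedding, d (-k) * p ^ (-k) * x i ^ k := by
      rw [hzd, Finsupp.sum, Finset.sum_map]
      refine Finset.sum_congr rfl fun k _ => ?_
      simp only [Equiv.coe_toEmbedding, Equiv.neg_apply, neg_neg, mul_zpow, inv_zpow', zpow_neg]
      ring
    rw [h1]
    refine Finset.sum_subset Finset.subset_union_right fun k _ hk => ?_
    have : d (-k) = 0 := by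
      by_contra hne
      exact hk (Finset.mem_map.2 ⟨-k, Finsupp.mem_support_iff.2 hne, by simp⟩)
    rw [this, zero_mul, zero_mul]
  have hpE : ∀ k : ℤ, p ^ k ∈ E := by
    intro k
    cases k with
    | ofNat n => simpa using pow_mem (hE hp) n
    | negSucc n => simpa [zpow_negSucc] using hEinv _ (pow_mem (hE hp) (n + 1))
  have hcoef := eq_zero_of_sum_mul_zpow_eq_zero htr s (fun k => c k - d (-k) * p ^ (-k))
    (fun k _ => sub_mem (hE (hc k)) (mul_mem (hE (hd _)) (hpE _)))
    (by simp only [sub_mul, Finset.sum_sub_distrib]; rw [← hcs, ← hds, sub_self])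
  rw [hcs]
  refine sum_mem fun k hk => ?_
  rcases le_total 0 k with h0 | h0
  · rw [← pow_toNat_of_nonneg _ h0]
    exact mul_mem (hA (hc k)) (pow_mem hxA _)
  · have h1 : c k = d (-k) * p ^ (-k) := sub_eq_zero.1 (hcoef k hk)
    have h2 : c k * x i ^ k = d (-k) * ((x i)⁻¹ * p) ^ (-k).toNat := by
      rw [h1, pow_toNat_of_nonneg _ (by omega), mul_zpow, inv_zpow', neg_neg]
      ring
    rw [h2]
    exact mul_mem (hA (hd _)) (pow_mem hxA' _)

/-- Replacing `x i` by `p / x i`, with `p` in the other variables, preserves algebraic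
independence. -/
theorem AlgebraicIndependent.update_inv_mul [DecidableEq σ] [Nontrivial K] {x : σ → F}
    (hx : AlgebraicIndependent K x) (i : σ) {p : F} (hp : p ∈ laurentSubalgebraCompl K x i)
    (hp0 : p ≠ 0) : AlgebraicIndependent K (Function.update x i ((x i)⁻¹ * p)) := by
  obtain ⟨E, hEinv, hE, htr, hE'⟩ := exists_subalgebra_transcendental hx i
  refine hE' _ fun halg => htr ?_
  have h1 : IsAlgebraic E p⁻¹ := isAlgebraic_algebraMap (⟨p⁻¹, hEinv _ (hE hp)⟩ : E)
  have h2 := (halg.mul h1).inv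
  rwa [mul_assoc, mul_inv_cancel₀ hp0, mul_one, inv_inv] at h2

/-- The denominators `P ^ N` and `Q ^ M`, for relatively prime polynomials `P` and `Q` in `x`, cancel. -/
theorem mem_laurentSubalgebra_of_isRelPrime [IsDomain K] [UniqueFactorizationMonoid K] {x : σ → F}
    (hx : AlgebraicIndependent K x) {P Q : MvPolynomial σ K} (hPQ : IsRelPrime P Q) (hP : P ≠ 0)
    {z : F} {N M : ℕ} (hz : aeval x P ^ N * z ∈ laurentSubalgebra K x)
    (hz' : aeval x Q ^ M * z ∈ laurentSubalgebra K x) : z ∈ laurentSubalgebra K x := by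
  have hx0 := hx.ne_zero
  obtain ⟨d, f, hf⟩ := (mem_laurentSubalgebra_iff hx0).1 hz
  obtain ⟨e, g, hg⟩ := (mem_laurentSubalgebra_iff hx0).1 hz'
  have key : f * monomial e 1 * Q ^ M = g * monomial d 1 * P ^ N := by
    apply hx
    simp only [map_mul, map_pow, ← hf, ← hg]
    ring
  have hdvd : P ^ N ∣ f * monomial e 1 :=
    (hPQ.pow : IsRelPrime (P ^ N) (Q ^ M)).dvd_of_dvd_mul_right ⟨_, key.trans (mul_comm _ _)⟩
  obtain ⟨h, hh⟩ := hdvd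
  refine (mem_laurentSubalgebra_iff hx0).2 ⟨d + e, h, ?_⟩
  have hP0 : aeval x P ≠ 0 := fun h0 => hP (hx (by rw [h0, map_zero]))
  have h1 := congrArg (aeval x) hh
  rw [map_mul, map_mul, map_pow, ← hf] at h1
  have h2 : aeval x (monomial (d + e) (1 : K)) =
      aeval x (monomial d (1 : K)) * aeval x (monomial e (1 : K)) := by
    rw [← map_mul, monomial_mul, one_mul]
  apply mul_left_cancel₀ (pow_ne_zero N hP0)
  rw [h2, ← h1]
  ring

end Laurent

/-! ### Exchange polynomials and their coprimality -/

section Coprimality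

theorem Polynomial.exists_eq_C_mul_X_pow_of_mul_eq {D : Type*} [CommRing D] [IsDomain D]
    {f g : Polynomial D} {a : D} {N : ℕ} (ha : a ≠ 0)
    (h : f * g = Polynomial.C a * Polynomial.X ^ N) :
    ∃ (b : D) (m : ℕ), f = Polynomial.C b * Polynomial.X ^ m := by
  have hne : f * g ≠ 0 := by
    rw [h]
    exact mul_ne_zero (by simpa using ha) (pow_ne_zero _ Polynomial.X_ne_zero)
  have hf := left_ne_zero_of_mul hne
  have hg := right_ne_zero_of_mul hne
  have h1 : f.natDegree + g.natDegree = N := by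
    rw [← Polynomial.natDegree_mul hf hg, h, Polynomial.natDegree_C_mul_X_pow _ _ ha]
  have h2 : f.natTrailingDegree + g.natTrailingDegree = N := by
    rw [← Polynomial.natTrailingDegree_mul hf hg, h, Polynomial.C_mul_X_pow_eq_monomial,
      Polynomial.natTrailingDegree_monomial ha]
  have h3 := f.natTrailingDegree_le_natDegree
  have h4 := g.natTrailingDegree_le_natDegree
  refine ⟨f.coeff f.natDegree, f.natDegree, Polynomial.ext fun n => ?_⟩
  rw [Polynomial.coeff_C_mul_X_pow]
  split_ifs with hn
  · rw [hn]
  · rcases lt_or_gt_of_ne hn with hlt | hgt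
    · exact Polynomial.coeff_eq_zero_of_lt_natTrailingDegree (by omega)
    · exact Polynomial.coeff_eq_zero_of_natDegree_lt hgt

theorem LaurentPolynomial.exists_eq_C_mul_T_of_mul_eq {D : Type*} [CommRing D] [IsDomain D]
    {f g : LaurentPolynomial D} {a : D} {n : ℤ} (ha : a ≠ 0)
    (h : f * g = LaurentPolynomial.C a * LaurentPolynomial.T n) :
    ∃ (b : D) (m : ℤ), f = LaurentPolynomial.C b * LaurentPolynomial.T m := by
  obtain ⟨r, f', hf'⟩ := f.exists_T_pow
  obtain ⟨s, g', hg'⟩ := g.exists_T_pow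
  have hmul : f' * (g' * Polynomial.X ^ n.natAbs) =
      Polynomial.C a * Polynomial.X ^ (n + n.natAbs + r + s).toNat := by
    apply Polynomial.toLaurent_injective
    rw [Polynomial.toLaurent_C_mul_X_pow, map_mul, map_mul, Polynomial.toLaurent_X_pow, hf', hg',
      Int.toNat_of_nonneg (by omega), LaurentPolynomial.T_add, LaurentPolynomial.T_add,
      LaurentPolynomial.T_add]
    linear_combination (LaurentPolynomial.T (n.natAbs : ℤ) * LaurentPolynomial.T (r : ℤ) *
      LaurentPolynomial.T (s : ℤ)) * h
  obtain ⟨b, m, hb⟩ := Polynomial.exists_eq_C_mul_X_pow_of_mul_eq ha hmul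
  refine ⟨b, m - r, ?_⟩
  rw [hb, Polynomial.toLaurent_C_mul_X_pow] at hf'
  rw [LaurentPolynomial.T_sub, ← mul_assoc, hf', LaurentPolynomial.mul_T_assoc, add_neg_cancel,
    LaurentPolynomial.T_zero, mul_one]

variable {K σ : Type*} [CommRing K] [Fintype σ]

/-- The exchange polynomial of an integer column `u`: the sum of the monomials with exponents the
positive part and the negative part of `u`. -/
noncomputable def exchangePolynomial (K : Type*) [CommRing K] (u : σ → ℤ) : MvPolynomial σ K :=
  (∏ k, X k ^ (u k).toNat) + ∏ k, X k ^ (-(u k)).toNat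

theorem prod_X_pow_eq_monomial_toNat (u : σ → ℕ) :
    (∏ k, X k ^ u k : MvPolynomial σ K) = monomial (Finsupp.equivFunOnFinite.symm u) 1 := by
  rw [monomial_eq, Finsupp.prod_fintype _ _ (by simp)]
  simp

theorem isRelPrime_prod_X_pow [IsDomain K] [UniqueFactorizationMonoid K] {u v : σ → ℕ}
    (h : ∀ k, u k = 0 ∨ v k = 0) :
    IsRelPrime (∏ k, X k ^ u k : MvPolynomial σ K) (∏ k, X k ^ v k) := by
  refine IsRelPrime.prod_left fun i _ => IsRelPrime.prod_right fun j _ => ?_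
  by_cases hij : i = j
  · subst hij
    rcases h i with h | h
    · rw [h, pow_zero]
      exact isRelPrime_one_left
    · rw [h, pow_zero]
      exact isRelPrime_one_right
  · have hX : IsRelPrime (X i : MvPolynomial σ K) (X j) := by
      rw [(X_prime (R := K) (i := i)).irreducible.isRelPrime_iff_not_dvd]
      intro hdvd
      have := (X_dvd_X (R := K)).1 hdvd
      tauto
    exact hX.pow

/-- Two exchange polynomials are relatively prime as soon as some weight `ℓ` vanishes on one column and
not on the other. A common divisor is homogeneous for the grading by `ℓ`, because the first
polynomial is; hence it divides each of the two monomials of the second one, which lie in different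
degrees and have no variable in common. -/
theorem isRelPrime_exchangePolynomial [IsDomain K] [UniqueFactorizationMonoid K]
    {u v ℓ : σ → ℤ} (hu : ∑ k, ℓ k * u k = 0)
    (hv : ∑ k, ℓ k * v k ≠ 0) (hu0 : exchangePolynomial K u ≠ 0) :
    IsRelPrime (exchangePolynomial K u) (exchangePolynomial K v) := by
  let φ : MvPolynomial σ K →ₐ[K] LaurentPolynomial (MvPolynomial σ K) :=
    aeval fun k => LaurentPolynomial.C (X k) * LaurentPolynomial.T (ℓ k)
  let ε : LaurentPolynomial (MvPolynomial σ K) →+* MvPolynomial σ K :=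
    LaurentPolynomial.eval₂ (RingHom.id _) 1
  have hε : ∀ f, ε (φ f) = f := by
    intro f
    induction f using MvPolynomial.induction_on with
    | C a =>
      simp only [φ, algHom_C]
      exact LaurentPolynomial.eval₂_C _ _ _
    | add p q hp hq => rw [map_add, map_add, hp, hq]
    | mul_X p k hp =>
      rw [map_mul, map_mul, hp]
      simp [φ, ε]
  have hT (g : σ → ℤ) : (∏ k, LaurentPolynomial.T (g k) : LaurentPolynomial (MvPolynomial σ K)) =
      LaurentPolynomial.T (∑ k, g k) := by
    classical
    induction (Finset.univ : Finset σ) using Finset.induction_on with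
    | empty => simp
    | insert a s ha ih => rw [Finset.prod_insert ha, Finset.sum_insert ha, ih, LaurentPolynomial.T_add]
  have hmon (w : σ → ℕ) : φ (∏ k, X k ^ w k) =
      LaurentPolynomial.C (∏ k, X k ^ w k) * LaurentPolynomial.T (∑ k, ℓ k * w k) := by
    simp only [φ, map_prod, map_pow, aeval_X, mul_pow, Finset.prod_mul_distrib,
      LaurentPolynomial.T_pow, hT]
    congr 2
    exact Finset.sum_congr rfl fun k _ => mul_comm _ _
  have hdiff (w : σ → ℤ) : ∑ k, ℓ k * ((w k).toNat : ℤ) - ∑ k, ℓ k * ((-(w k)).toNat : ℤ) =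
      ∑ k, ℓ k * w k := by
    rw [← Finset.sum_sub_distrib]
    refine Finset.sum_congr rfl fun k _ => ?_
    rw [← mul_sub]
    congr 1
    omega
  intro d hdu hdv
  obtain ⟨e, he⟩ := hdu
  obtain ⟨e', he'⟩ := hdv
  have hφu : φ d * φ e = LaurentPolynomial.C (exchangePolynomial K u) *
      LaurentPolynomial.T (∑ k, ℓ k * ((u k).toNat : ℤ)) := by
    rw [← map_mul, ← he]
    have h := hdiff u
    rw [hu, sub_eq_zero] at h
    rw [exchangePolynomial, map_add, hmon, hmon, ← h, map_add, add_mul]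
  obtain ⟨b, m, hb⟩ := LaurentPolynomial.exists_eq_C_mul_T_of_mul_eq hu0 hφu
  have hbd : b = d := by
    have := hε d
    rw [hb] at this
    simpa [ε] using this
  subst hbd
  set r := ∑ k, ℓ k * ((v k).toNat : ℤ)
  set s := ∑ k, ℓ k * ((-(v k)).toNat : ℤ)
  have hrs : r ≠ s := fun h => hv (by rw [← hdiff v, sub_eq_zero]; exact h)
  set M : MvPolynomial σ K := ∏ k, X k ^ (v k).toNat
  set N : MvPolynomial σ K := ∏ k, X k ^ (-(v k)).toNat
  have hφv : LaurentPolynomial.C b * (LaurentPolynomial.T m * φ e') =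
      LaurentPolynomial.C M * LaurentPolynomial.T r +
        LaurentPolynomial.C N * LaurentPolynomial.T s := by
    rw [← mul_assoc, ← hb, ← map_mul, ← he', exchangePolynomial, map_add, hmon, hmon]
  rw [← LaurentPolynomial.smul_eq_C_mul, ← LaurentPolynomial.smul_eq_C_mul,
    ← LaurentPolynomial.smul_eq_C_mul] at hφv
  have hr := congrArg (fun f => f.coeff r) hφv
  have hs := congrArg (fun f => f.coeff s) hφv
  simp [hrs, hrs.symm] at hr hs
  exact isRelPrime_prod_X_pow (K := K) (u := fun k => (v k).toNat) (v := fun k => (-(v k)).toNat)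
    (fun k => by omega) ⟨_, hr.symm⟩ ⟨_, hs.symm⟩

theorem exchangePolynomial_ne_zero [CharZero K] (u : σ → ℤ) : exchangePolynomial K u ≠ 0 := by
  intro h
  have := congrArg (eval fun _ => (1 : K)) h
  simp [exchangePolynomial] at this
  norm_num at this

end Coprimality

/-! ### Mutation of exchange matrices -/

section ExchangeMatrix

/-- The correction term of matrix mutation without the division by `2`. -/
theorem abs_mul_add_mul_abs_ediv_two (a c : ℤ) :
    (|a| * c + a * |c|) / 2 = max a 0 * max c 0 - max (-a) 0 * max (-c) 0 := by
  rcases le_total 0 a with ha | ha <;> rcases le_total 0 c with hc | hc <;>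
    simp only [abs_of_nonneg, abs_of_nonpos, max_eq_left, max_eq_right, ha, hc,
      neg_nonneg.2, neg_nonpos.2]
  · rw [← two_mul, Int.mul_ediv_cancel_left _ two_ne_zero]
    ring
  · rw [show a * c + a * -c = 0 by ring]
    simp
  · rw [show -a * c + a * c = 0 by ring]
    simp
  · rw [show -a * c + a * -c = 2 * (-(a * c)) by ring, Int.mul_ediv_cancel_left _ two_ne_zero]
    ring

variable {ι κ : Type*} {B : Matrix (ι ⊕ κ) ι ℤ}

theorem IsExchangeMatrix.apply_self (hB : IsExchangeMatrix B) (i : ι) : B (Sum.inl i) i = 0 := by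
  obtain ⟨d, hd, h⟩ := hB
  have h1 := h i i
  have h2 := hd i
  have : (d i : ℤ) * B (Sum.inl i) i = 0 := by linarith
  rcases mul_eq_zero.1 this with h3 | h3
  · omega
  · exact h3

theorem IsExchangeMatrix.apply_eq_zero (hB : IsExchangeMatrix B) {i j : ι}
    (h0 : B (Sum.inl i) j = 0) : B (Sum.inl j) i = 0 := by
  obtain ⟨d, hd, h⟩ := hB
  have h1 := h i j
  have h2 := hd j
  rw [h0, mul_zero, zero_eq_neg] at h1
  rcases mul_eq_zero.1 h1 with h3 | h3
  · omega
  · exact h3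

theorem IsExchangeMatrix.apply_neg (hB : IsExchangeMatrix B) {i j : ι}
    (hpos : 0 < B (Sum.inl j) i) : B (Sum.inl i) j < 0 := by
  obtain ⟨d, hd, h⟩ := hB
  have h1 := h i j
  have h2 : (0 : ℤ) < d j := by exact_mod_cast hd j
  have h3 : (0 : ℤ) < d i := by exact_mod_cast hd i
  have h4 := mul_pos h2 hpos
  by_contra h5
  have := mul_nonneg h3.le (not_lt.1 h5)
  omega

theorem IsExchangeMatrix.neg (hB : IsExchangeMatrix B) : IsExchangeMatrix (-B) := by
  obtain ⟨d, hd, h⟩ := hB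
  refine ⟨d, hd, fun i j => ?_⟩
  simp only [Matrix.neg_apply, mul_neg, h i j]

variable [DecidableEq ι] [DecidableEq κ]

theorem mutateMatrix_apply_of_ne (B : Matrix (ι ⊕ κ) ι ℤ) {i k : ι} {j : ι ⊕ κ}
    (hj : j ≠ Sum.inl i) (hk : k ≠ i) :
    SeedData.mutateMatrix B i j k = B j k + (max (B j i) 0 * max (B (Sum.inl i) k) 0 -
      max (-(B j i)) 0 * max (-(B (Sum.inl i) k)) 0) := by
  rw [SeedData.mutateMatrix, if_neg (by tauto), abs_mul_add_mul_abs_ediv_two]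

theorem mutateMatrix_apply_of_eq (B : Matrix (ι ⊕ κ) ι ℤ) {i k : ι} {j : ι ⊕ κ}
    (h : j = Sum.inl i ∨ k = i) : SeedData.mutateMatrix B i j k = -(B j k) := by
  rw [SeedData.mutateMatrix, if_pos h]

theorem mutateMatrix_mutateMatrix (B : Matrix (ι ⊕ κ) ι ℤ) (i : ι) :
    SeedData.mutateMatrix (SeedData.mutateMatrix B i) i = B := by
  ext j k
  by_cases h : j = Sum.inl i ∨ k = i
  · rw [mutateMatrix_apply_of_eq _ h, mutateMatrix_apply_of_eq _ h, neg_neg]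
  · push Not at h
    rw [mutateMatrix_apply_of_ne _ h.1 h.2, mutateMatrix_apply_of_ne _ h.1 h.2,
      mutateMatrix_apply_of_eq _ (Or.inr rfl), mutateMatrix_apply_of_eq _ (Or.inl rfl)]
    simp only [neg_neg]
    ring

theorem mutateMatrix_neg (B : Matrix (ι ⊕ κ) ι ℤ) (i : ι) :
    SeedData.mutateMatrix (-B) i = -SeedData.mutateMatrix B i := by
  ext j k
  by_cases h : j = Sum.inl i ∨ k = i
  · rw [Matrix.neg_apply, mutateMatrix_apply_of_eq _ h, mutateMatrix_apply_of_eq _ h,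
      Matrix.neg_apply]
  · push Not at h
    rw [Matrix.neg_apply, mutateMatrix_apply_of_ne _ h.1 h.2, mutateMatrix_apply_of_ne _ h.1 h.2]
    simp only [Matrix.neg_apply, neg_neg]
    ring

theorem IsExchangeMatrix.mutateMatrix (hB : IsExchangeMatrix B) (i : ι) :
    IsExchangeMatrix (SeedData.mutateMatrix B i) := by
  obtain ⟨d, hd, h⟩ := hB
  refine ⟨d, hd, fun j k => ?_⟩
  by_cases hjk : j = i ∨ k = i
  · rw [mutateMatrix_apply_of_eq B (j := Sum.inl j) (by simpa using hjk),
      mutateMatrix_apply_of_eq B (j := Sum.inl k) (by simpa using hjk.symm)]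
    linarith [h j k]
  · push Not at hjk
    rw [mutateMatrix_apply_of_ne B (j := Sum.inl j) (by simpa using hjk.1) hjk.2,
      mutateMatrix_apply_of_ne B (j := Sum.inl k) (by simpa using hjk.2) hjk.1]
    -- The positive part of `d p * b_pq` is the negative part of `d q * b_qp`.
    have hmax (p q : ι) : (d p : ℤ) * max (B (Sum.inl p) q) 0 =
        d q * max (-(B (Sum.inl q) p)) 0 := by
      rw [mul_max_of_nonneg _ _ (by positivity), mul_max_of_nonneg _ _ (by positivity), h p q]
      simp
    have h1 := hmax j i
    have h2 := hmax i j
    have h3 := hmax k i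
    have h4 := hmax i k
    have h5 := h j k
    linear_combination h5 + max (B (Sum.inl i) k) 0 * h1 + max (-(B (Sum.inl i) j)) 0 * h4
      + max (-(B (Sum.inl i) k)) 0 * h2 + max (B (Sum.inl i) j) 0 * h3

/-- Matrix mutation acts on columns by invertible column operations followed by an injective linear
map, so it preserves the linear independence of the columns. -/
theorem linearIndependent_col_mutateMatrix [Fintype ι] (hB : IsExchangeMatrix B)
    (hli : LinearIndependent ℤ fun k j => B j k) (i : ι) :
    LinearIndependent ℤ fun k j => SeedData.mutateMatrix B i j k := by
  rw [Fintype.linearIndependent_iff] at hli ⊢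
  intro c hc
  -- The linear map sends the combination of the columns of `B` with coefficients `c'` to the combination
  -- of the mutated columns with coefficients `c`.
  set e : ι → ℤ := fun k => max (-(B (Sum.inl i) k)) 0
  have he : e i = 0 := by simp [e, hB.apply_self i]
  set c' : ι → ℤ := fun k => if k = i then ∑ l, c l * e l - c i else c k
  have hrow (j : ι ⊕ κ) : ∑ k, c' k * B j k = ∑ k, c k * (B j k + e k * B j i) - 2 * c i * B j i := by
    have h1 : ∑ k, c' k * B j k = ∑ k, (c k * B j k +
        if k = i then (∑ l, c l * e l - c i - c i) * B j i else 0) := by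
      refine Finset.sum_congr rfl fun k _ => ?_
      by_cases hk : k = i
      · subst hk
        simp only [c', if_true]
        ring
      · simp [c', hk]
    rw [h1, Finset.sum_add_distrib, Finset.sum_ite_eq' Finset.univ i, if_pos (Finset.mem_univ _)]
    simp only [mul_add, Finset.sum_add_distrib, ← mul_assoc, ← Finset.sum_mul]
    ring
  have hc0 (j : ι ⊕ κ) : ∑ k, c k * SeedData.mutateMatrix B i j k = 0 := by
    have := congrFun hc j
    simpa using this
  have hmut (j : ι ⊕ κ) (hj : j ≠ Sum.inl i) (k : ι) : SeedData.mutateMatrix B i j k =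
      B j k + e k * B j i + max (B j i) 0 * B (Sum.inl i) k - (if k = i then 2 * B j i else 0) := by
    by_cases hk : k = i
    · subst hk
      rw [mutateMatrix_apply_of_eq _ (Or.inr rfl), he, hB.apply_self, if_pos rfl]
      ring
    · rw [mutateMatrix_apply_of_ne _ hj hk, if_neg hk]
      have h1 (a : ℤ) : a = max a 0 - max (-a) 0 := by
        rcases le_total 0 a with h | h <;> simp [h]
      have h2 := h1 (B j i)
      have h3 := h1 (B (Sum.inl i) k)
      simp only [e]
      linear_combination (-max (-(B (Sum.inl i) k)) 0) * h2 - max (B j i) 0 * h3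
  have hci : ∑ k, c k * B (Sum.inl i) k = 0 := by
    have := hc0 (Sum.inl i)
    simp only [mutateMatrix_apply_of_eq B (Or.inl rfl : Sum.inl i = Sum.inl i ∨ _), mul_neg,
      Finset.sum_neg_distrib, neg_eq_zero] at this
    exact this
  have hzero : ∑ k, c' k • (fun j => B j k) = 0 := by
    funext j
    simp only [Finset.sum_apply, Pi.smul_apply, smul_eq_mul, Pi.zero_apply]
    rw [hrow]
    by_cases hj : j = Sum.inl i
    · subst hj
      simp [hB.apply_self, hci]
    · have := hc0 j
      simp only [hmut j hj, mul_sub, mul_add, mul_ite, mul_zero, Finset.sum_sub_distrib,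
        Finset.sum_add_distrib, Finset.sum_ite_eq', Finset.mem_univ, if_true] at this
      have h2 : ∑ k, c k * (max (B j i) 0 * B (Sum.inl i) k) = 0 := by
        simp only [mul_left_comm (c _), ← Finset.mul_sum, hci, mul_zero]
      rw [h2] at this
      simp only [mul_add, Finset.sum_add_distrib]
      linarith
  have hc' := hli c' hzero
  have hne : ∀ k, k ≠ i → c k = 0 := fun k hk => by simpa [c', hk] using hc' k
  intro k
  by_cases hk : k = i
  · subst hk
    have h1 := hc' k
    have h2 : ∑ l, c l * e l = 0 := Finset.sum_eq_zero fun l _ => by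
      by_cases hl : l = k
      · rw [hl, he, mul_zero]
      · rw [hne l hl, zero_mul]
    simp only [c', if_true, h2] at h1
    omega
  · exact hne k hk

theorem exists_weight_of_linearIndependent {σ ι' : Type*} [Fintype σ] [DecidableEq σ]
    {v : ι' → σ → ℤ} (hv : LinearIndependent ℤ v) {i j : ι'} (hij : i ≠ j) :
    ∃ ℓ : σ → ℤ, ∑ k, ℓ k * v i k = 0 ∧ ∑ k, ℓ k * v j k ≠ 0 := by
  obtain ⟨a, ha⟩ : ∃ a, v i a ≠ 0 := Function.ne_iff.1 (hv.ne_zero i)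
  obtain ⟨b, hb⟩ : ∃ b, v i a * v j b - v i b * v j a ≠ 0 := by
    by_contra! hall
    have hpair : LinearIndependent ℤ ![v j, v i] := by
      have := hv.comp ![j, i] (by
        intro p q hpq
        fin_cases p <;> fin_cases q <;> simp_all [hij.symm])
      convert this using 1
      ext p
      fin_cases p <;> rfl
    have := LinearIndependent.pair_iff.1 hpair (v i a) (-(v j a)) (by
      funext b
      have := hall b
      simp only [Pi.add_apply, Pi.smul_apply, smul_eq_mul, Pi.zero_apply]
      linarith)
    exact ha this.1
  refine ⟨fun k => (if k = b then v i a else 0) - if k = a then v i b else 0, ?_, ?_⟩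
  · simp only [sub_mul, Finset.sum_sub_distrib, ite_mul, zero_mul, Finset.sum_ite_eq',
      Finset.mem_univ, if_true]
    ring
  · simpa only [sub_mul, Finset.sum_sub_distrib, ite_mul, zero_mul, Finset.sum_ite_eq',
      Finset.mem_univ, if_true] using hb

end ExchangeMatrix

/-! ### Exchange relations and the rank two step -/

namespace SeedData

variable {K F ι κ : Type*} [CommRing K] [Field F] [Algebra K F]
  [Fintype ι] [Fintype κ]

theorem exchange_eq_aeval (T : SeedData F ι κ) (i : ι) :
    T.exchange i = aeval T.var (exchangePolynomial K fun k => T.B k i) := by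
  simp [exchange, exchangePolynomial]

theorem exchange_ne_zero [CharZero K] {T : SeedData F ι κ}
    (hT : AlgebraicIndependent K T.var) (i : ι) : T.exchange i ≠ 0 := by
  rw [exchange_eq_aeval (K := K)]
  intro h
  exact exchangePolynomial_ne_zero _ (hT (by rw [h, map_zero]))

theorem prod_pow_mem {σ : Type*} {A : Subalgebra K F} {x : σ → F} {e : σ → ℕ} (s : Finset σ)
    (h : ∀ k ∈ s, e k = 0 ∨ x k ∈ A) : ∏ k ∈ s, x k ^ e k ∈ A :=
  prod_mem fun k hk => by
    rcases h k hk with h | h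
    · rw [h, pow_zero]
      exact one_mem A
    · exact pow_mem h _

theorem inv_prod_pow_mem {σ : Type*} {A : Subalgebra K F} {x : σ → F} {e : σ → ℕ} (s : Finset σ)
    (h : ∀ k ∈ s, e k = 0 ∨ (x k)⁻¹ ∈ A) : (∏ k ∈ s, x k ^ e k)⁻¹ ∈ A := by
  rw [← Finset.prod_inv_distrib]
  simp only [← inv_pow]
  exact prod_pow_mem s h

theorem exchange_mem {T : SeedData F ι κ} {i : ι} {A : Subalgebra K F}
    (h : ∀ k, T.B k i = 0 ∨ T.var k ∈ A) : T.exchange i ∈ A := by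
  refine add_mem (prod_pow_mem _ fun k _ => ?_) (prod_pow_mem _ fun k _ => ?_) <;>
    rcases h k with h | h <;> simp [h]

theorem exchange_mem_laurentSubalgebraCompl {T : SeedData F ι κ} (hB : IsExchangeMatrix T.B)
    (i : ι) : T.exchange i ∈ laurentSubalgebraCompl K T.var (Sum.inl i) := by
  refine exchange_mem fun k => ?_
  by_cases hk : k = Sum.inl i
  · exact Or.inl (by rw [hk, hB.apply_self])
  · exact Or.inr (mem_laurentSubalgebraCompl T.var hk)

/-- The exchange polynomial depends only on the variables with a nonzero entry in the column. -/
theorem exchange_congr {T T' : SeedData F ι κ} {i i' : ι} (hB : ∀ k, T.B k i = T'.B k i')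
    (hvar : ∀ k, T.B k i = 0 ∨ T.var k = T'.var k) : T.exchange i = T'.exchange i' := by
  unfold exchange
  congr 1 <;> refine Finset.prod_congr rfl fun k _ => ?_ <;> rw [← hB k] <;>
    rcases hvar k with h | h <;> simp [h]

theorem exchange_eq_of_neg {T T' : SeedData F ι κ} {i : ι} (hB : ∀ k, T'.B k i = -T.B k i)
    (hvar : ∀ k, T.B k i = 0 ∨ T.var k = T'.var k) : T'.exchange i = T.exchange i := by
  unfold exchange
  rw [add_comm]
  congr 1 <;> refine Finset.prod_congr rfl fun k _ => ?_ <;> rw [hB k] <;>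
    rcases hvar k with h | h <;> simp [h]

variable [DecidableEq ι] [DecidableEq κ]

theorem mutate_var_self (T : SeedData F ι κ) (i : ι) :
    (T.mutate i).var (Sum.inl i) = (T.var (Sum.inl i))⁻¹ * T.exchange i :=
  Function.update_self _ _ _

theorem mutate_var_of_ne (T : SeedData F ι κ) {i : ι} {k : ι ⊕ κ} (hk : k ≠ Sum.inl i) :
    (T.mutate i).var k = T.var k :=
  Function.update_of_ne hk _ _

theorem mutate_B (T : SeedData F ι κ) (i : ι) : (T.mutate i).B = mutateMatrix T.B i := rfl

theorem algebraicIndependent_mutate [IsDomain K] [CharZero K] {T : SeedData F ι κ}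
    (hT : AlgebraicIndependent K T.var) (hB : IsExchangeMatrix T.B) (i : ι) :
    AlgebraicIndependent K (T.mutate i).var :=
  hT.update_inv_mul _ (exchange_mem_laurentSubalgebraCompl hB i) (exchange_ne_zero hT i)

theorem mutate_exchange_self {T : SeedData F ι κ} (hB : IsExchangeMatrix T.B) (i : ι) :
    (T.mutate i).exchange i = T.exchange i := by
  refine exchange_eq_of_neg (fun k => ?_) fun k => ?_
  · rw [mutate_B, mutateMatrix_apply_of_eq _ (Or.inr rfl)]
  · by_cases hk : k = Sum.inl i
    · exact Or.inl (by rw [hk, hB.apply_self])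
    · exact Or.inr (mutate_var_of_ne T hk).symm

theorem mutate_mutate [Nontrivial K] [CharZero K] {T : SeedData F ι κ}
    (hT : AlgebraicIndependent K T.var) (hB : IsExchangeMatrix T.B) (i : ι) :
    (T.mutate i).mutate i = T := by
  have hvar : ((T.mutate i).mutate i).var = T.var := by
    funext k
    by_cases hk : k = Sum.inl i
    · subst hk
      rw [mutate_var_self, mutate_exchange_self hB, mutate_var_self, mul_inv, inv_inv, mul_assoc,
        inv_mul_cancel₀ (exchange_ne_zero hT i), mul_one]
    · rw [mutate_var_of_ne _ hk, mutate_var_of_ne _ hk]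
  have hmat : ((T.mutate i).mutate i).B = T.B := mutateMatrix_mutateMatrix T.B i
  calc (T.mutate i).mutate i
      = ⟨((T.mutate i).mutate i).var, ((T.mutate i).mutate i).B⟩ := rfl
    _ = ⟨T.var, T.B⟩ := by rw [hvar, hmat]
    _ = T := rfl

/-- The seed with the opposite exchange matrix, which has the same exchange relations. -/
def opposite (T : SeedData F ι κ) : SeedData F ι κ := ⟨T.var, -T.B⟩

theorem opposite_mutate (T : SeedData F ι κ) (i : ι) :
    T.opposite.mutate i = (T.mutate i).opposite := by
  have h : T.opposite.exchange i = T.exchange i :=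
    exchange_eq_of_neg (fun _ => rfl) fun _ => Or.inr rfl
  have h1 : (T.opposite.mutate i).var = (T.mutate i).var := by
    funext k
    by_cases hk : k = Sum.inl i
    · subst hk
      rw [mutate_var_self, mutate_var_self, h]
      rfl
    · rw [mutate_var_of_ne _ hk, mutate_var_of_ne _ hk]
      rfl
  have h2 : (T.opposite.mutate i).B = -(T.mutate i).B := mutateMatrix_neg T.B i
  calc T.opposite.mutate i = ⟨(T.opposite.mutate i).var, (T.opposite.mutate i).B⟩ := rfl
    _ = (T.mutate i).opposite := by rw [h1, h2]; rfl

/-- The comparison of the exchange polynomials `P_j = M_j + N_j` before and after a mutation in a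
direction `i` with `b_ji > 0`: the ratio of the two monomials gets multiplied by `(P_i / N_i) ^ (-b_ij)`. -/
theorem prod_mul_prod_mutate_eq [IsDomain K] [CharZero K] {T : SeedData F ι κ}
    (hT : AlgebraicIndependent K T.var) (hB : IsExchangeMatrix T.B) {i j : ι} (hij : i ≠ j)
    (hpos : 0 < T.B (Sum.inl j) i) :
    (∏ k, (T.mutate i).var k ^ ((T.mutate i).B k j).toNat) *
        ((∏ k, T.var k ^ (-(T.B k j)).toNat) *
          (∏ k, T.var k ^ (-(T.B k i)).toNat) ^ (-(T.B (Sum.inl i) j)).toNat) =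
      (∏ k, T.var k ^ (T.B k j).toNat) *
        ((∏ k, (T.mutate i).var k ^ (-((T.mutate i).B k j)).toNat) *
          T.exchange i ^ (-(T.B (Sum.inl i) j)).toNat) := by
  have hneg := hB.apply_neg hpos
  set b := (-(T.B (Sum.inl i) j)).toNat with hb
  have hself : (T.mutate i).B (Sum.inl i) j = -T.B (Sum.inl i) j :=
    mutateMatrix_apply_of_eq _ (Or.inl rfl)
  have hx := hT.ne_zero (Sum.inl i)
  have hexch : T.exchange i = T.var (Sum.inl i) * (T.mutate i).var (Sum.inl i) := by
    rw [mutate_var_self, mul_inv_cancel_left₀ hx]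
  rw [← Finset.mul_prod_erase Finset.univ (fun k => (T.mutate i).var k ^ _)
      (Finset.mem_univ (Sum.inl i)),
    ← Finset.mul_prod_erase Finset.univ (fun k => (T.mutate i).var k ^ (-_ : ℤ).toNat)
      (Finset.mem_univ (Sum.inl i)),
    ← Finset.mul_prod_erase Finset.univ (fun k => T.var k ^ (-(T.B k j)).toNat)
      (Finset.mem_univ (Sum.inl i)),
    ← Finset.mul_prod_erase Finset.univ (fun k => T.var k ^ (T.B k j).toNat)
      (Finset.mem_univ (Sum.inl i)),
    ← Finset.mul_prod_erase Finset.univ (fun k => T.var k ^ (-(T.B k i)).toNat)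
      (Finset.mem_univ (Sum.inl i)), hself, neg_neg, hB.apply_self, ← hb, hexch,
    Int.toNat_of_nonpos hneg.le]
  simp only [neg_zero, Int.toNat_zero, pow_zero, one_mul]
  have hprod : (∏ k ∈ Finset.univ.erase (Sum.inl i),
        (T.mutate i).var k ^ ((T.mutate i).B k j).toNat) *
      ((∏ k ∈ Finset.univ.erase (Sum.inl i), T.var k ^ (-(T.B k j)).toNat) *
        (∏ k ∈ Finset.univ.erase (Sum.inl i), T.var k ^ (-(T.B k i)).toNat) ^ b) =
      (∏ k ∈ Finset.univ.erase (Sum.inl i), T.var k ^ (T.B k j).toNat) *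
        ∏ k ∈ Finset.univ.erase (Sum.inl i),
          (T.mutate i).var k ^ (-((T.mutate i).B k j)).toNat := by
    rw [← Finset.prod_pow, ← Finset.prod_mul_distrib, ← Finset.prod_mul_distrib,
      ← Finset.prod_mul_distrib]
    refine Finset.prod_congr rfl fun k hk => ?_
    have hk' := Finset.ne_of_mem_erase hk
    rw [mutate_var_of_ne _ hk', mutate_B, mutateMatrix_apply_of_ne _ hk' hij.symm,
      max_eq_right hneg.le, mul_zero, zero_sub,
      max_eq_left (show (0 : ℤ) ≤ -(T.B (Sum.inl i) j) by omega), ← pow_mul, ← pow_add,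
      ← pow_add, ← pow_add]
    congr 1
    zify
    simp only [Int.ofNat_toNat, hb]
    rw [max_eq_left (show (0 : ℤ) ≤ -(T.B (Sum.inl i) j) by omega)]
    set u := max (-(T.B k i)) 0 * -(T.B (Sum.inl i) j)
    have hmax (a : ℤ) : max a 0 = a + max (-a) 0 := by
      rcases le_total 0 a with h | h <;> simp [h]
    rw [hmax (T.B k j + -u), hmax (T.B k j)]
    ring
  rw [mul_pow]
  linear_combination (T.var (Sum.inl i) ^ b * (T.mutate i).var (Sum.inl i) ^ b) * hprod

/-- The rank two step when `b_ji > 0`. With `L` the Laurent ring of the seed mutated at `i` and then at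
`j`, the variable mutated at `j` alone lies in `L`, and the two exchange polynomials are comaximal
in `L`. -/
theorem mem_laurentRing_mutate_mutate_of_pos [IsDomain K] [CharZero K] {T : SeedData F ι κ}
    (hT : AlgebraicIndependent K T.var) (hB : IsExchangeMatrix T.B) {i j : ι} (hij : i ≠ j)
    (hpos : 0 < T.B (Sum.inl j) i) {z : F} (hz : z ∈ T.laurentRing K)
    (hzi : z ∈ (T.mutate i).laurentRing K) (hzj : z ∈ (T.mutate j).laurentRing K) :
    z ∈ ((T.mutate i).mutate j).laurentRing K := by
  have hT1 := algebraicIndependent_mutate hT hB i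
  have hB1 : IsExchangeMatrix (T.mutate i).B := hB.mutateMatrix i
  set A := ((T.mutate i).mutate j).laurentRing K
  have habne : (Sum.inl i : ι ⊕ κ) ≠ Sum.inl j := by simpa using hij
  have hAmem (k : ι ⊕ κ) : ((T.mutate i).mutate j).var k ∈ A :=
    mem_laurentSubalgebra (K := K) ((T.mutate i).mutate j).var k
  have hAinv (k : ι ⊕ κ) : (((T.mutate i).mutate j).var k)⁻¹ ∈ A :=
    inv_mem_laurentSubalgebra (K := K) ((T.mutate i).mutate j).var k
  have h1mem (k : ι ⊕ κ) (hk : k ≠ Sum.inl j) : (T.mutate i).var k ∈ A := by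
    rw [← mutate_var_of_ne _ hk]
    exact hAmem k
  have h1inv (k : ι ⊕ κ) (hk : k ≠ Sum.inl j) : ((T.mutate i).var k)⁻¹ ∈ A := by
    rw [← mutate_var_of_ne (T.mutate i) hk]
    exact hAinv k
  have h0inv (k : ι ⊕ κ) (hki : k ≠ Sum.inl i) (hkj : k ≠ Sum.inl j) : (T.var k)⁻¹ ∈ A := by
    rw [← mutate_var_of_ne T hki]
    exact h1inv k hkj
  -- the exchange polynomial `Q` of the second mutation, and `x_j = Q / x_j''`
  set Q := (T.mutate i).exchange j
  have hQ0 : Q ≠ 0 := exchange_ne_zero hT1 j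
  have hQA : Q ∈ A := exchange_mem fun k => by
    by_cases hk : k = Sum.inl j
    · exact Or.inl (by rw [hk, hB1.apply_self])
    · exact Or.inr (h1mem k hk)
  set y := ((T.mutate i).mutate j).var (Sum.inl j) with hy
  have hxj0 := hT.ne_zero (Sum.inl j)
  have hyx : y = (T.var (Sum.inl j))⁻¹ * Q := by
    rw [hy, mutate_var_self, mutate_var_of_ne _ habne.symm]
  have hxjQ : T.var (Sum.inl j) = y⁻¹ * Q := by
    rw [hyx, mul_inv, inv_inv, mul_assoc, inv_mul_cancel₀ hQ0, mul_one]
  have hxj : T.var (Sum.inl j) ∈ A := by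
    rw [hxjQ]
    exact mul_mem (hAinv _) hQA
  have h0mem' (k : ι ⊕ κ) (hk : k ≠ Sum.inl i) : T.var k ∈ A := by
    by_cases hkj : k = Sum.inl j
    · rw [hkj]
      exact hxj
    · rw [← mutate_var_of_ne T hk]
      exact h1mem k hkj
  have hPA : T.exchange i ∈ A := exchange_mem fun k => by
    by_cases hk : k = Sum.inl i
    · exact Or.inl (by rw [hk, hB.apply_self])
    · exact Or.inr (h0mem' k hk)
  have hP0 : T.exchange i ≠ 0 := exchange_ne_zero hT i
  have hxi : T.var (Sum.inl i) ∈ A := by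
    have : T.var (Sum.inl i) = ((T.mutate i).var (Sum.inl i))⁻¹ * T.exchange i := by
      rw [mutate_var_self, mul_inv, inv_inv, mul_assoc, inv_mul_cancel₀ hP0, mul_one]
    rw [this]
    exact mul_mem (h1inv _ habne) hPA
  have h0mem (k : ι ⊕ κ) : T.var k ∈ A := by
    by_cases hk : k = Sum.inl i
    · rw [hk]
      exact hxi
    · exact h0mem' k hk
  -- `P_i = N + x_j * G` with `N` a unit of `A`
  set N := ∏ k, T.var k ^ (-(T.B k i)).toNat
  have hN0 : N ≠ 0 := Finset.prod_ne_zero_iff.mpr fun k _ => pow_ne_zero _ (hT.ne_zero k)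
  have hNinv : N⁻¹ ∈ A := inv_prod_pow_mem _ fun k _ => by
    by_cases hki : k = Sum.inl i
    · exact Or.inl (by simp [hki, hB.apply_self])
    by_cases hkj : k = Sum.inl j
    · exact Or.inl (by rw [hkj]; omega)
    · exact Or.inr (h0inv k hki hkj)
  obtain ⟨G, hGA, hG⟩ : ∃ G ∈ A, T.exchange i = N + T.var (Sum.inl j) * G := by
    refine ⟨T.var (Sum.inl j) ^ ((T.B (Sum.inl j) i).toNat - 1) *
      ∏ k ∈ Finset.univ.erase (Sum.inl j), T.var k ^ (T.B k i).toNat,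
      mul_mem (pow_mem hxj _) (prod_pow_mem _ fun k _ => Or.inr (h0mem k)), ?_⟩
    rw [exchange, add_comm, ← mul_assoc, ← pow_succ', Nat.sub_add_cancel (by omega),
      Finset.mul_prod_erase Finset.univ (fun k => T.var k ^ (T.B k i).toNat) (Finset.mem_univ _)]
  -- the variable of the single mutation at `j`
  have hxj' : (T.var (Sum.inl j))⁻¹ * T.exchange j ∈ A := by
    have hid := prod_mul_prod_mutate_eq hT hB hij hpos
    set b := (-(T.B (Sum.inl i) j)).toNat
    set M₀ := ∏ k, T.var k ^ (T.B k j).toNat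
    set N₀ := ∏ k, T.var k ^ (-(T.B k j)).toNat
    set M₁ := ∏ k, (T.mutate i).var k ^ ((T.mutate i).B k j).toNat
    set N₁ := ∏ k, (T.mutate i).var k ^ (-((T.mutate i).B k j)).toNat
    have hN₁0 : N₁ ≠ 0 := Finset.prod_ne_zero_iff.mpr fun k _ => pow_ne_zero _ (hT1.ne_zero k)
    have hN₁inv : N₁⁻¹ ∈ A := inv_prod_pow_mem _ fun k _ => by
      by_cases hkj : k = Sum.inl j
      · exact Or.inl (by simp [hkj, hB1.apply_self])
      · exact Or.inr (h1inv k hkj)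
    have hM₀A : M₀ ∈ A := prod_pow_mem _ fun k _ => Or.inr (h0mem k)
    have hN₀A : N₀ ∈ A := prod_pow_mem _ fun k _ => Or.inr (h0mem k)
    set w := N⁻¹ * G
    have hwA : w ∈ A := mul_mem hNinv hGA
    obtain ⟨q, hqA, hq⟩ : ∃ q ∈ A, (1 + T.var (Sum.inl j) * w) ^ b - 1 =
        T.var (Sum.inl j) * q := by
      have hdvd := sub_dvd_pow_sub_pow
        ((⟨1 + T.var (Sum.inl j) * w, add_mem (one_mem A) (mul_mem hxj hwA)⟩ : A)) 1 b
      obtain ⟨⟨r, hrA⟩, hr⟩ := hdvd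
      have hr' := congrArg Subtype.val hr
      simp only [one_pow] at hr'
      change (1 + T.var (Sum.inl j) * w) ^ b - 1 = (1 + T.var (Sum.inl j) * w - 1) * r at hr'
      exact ⟨w * r, mul_mem hwA hrA, by rw [hr']; ring⟩
    have hPN : T.exchange i = N * (1 + T.var (Sum.inl j) * w) := by
      rw [hG, mul_add, mul_one]
      simp only [w]
      field_simp
    have hM₁ : M₁ * N₀ = M₀ * N₁ * (1 + T.var (Sum.inl j) * w) ^ b := by
      rw [hPN, mul_pow] at hid
      apply mul_right_cancel₀ (pow_ne_zero b hN0)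
      linear_combination hid
    have hQ : Q = M₁ + N₁ := rfl
    have hfinal : (T.var (Sum.inl j))⁻¹ * T.exchange j = N₀ * N₁⁻¹ * y - M₀ * q := by
      have hPj : T.exchange j = M₀ + N₀ := rfl
      rw [hPj, hyx, hQ]
      have h1 : N₁⁻¹ * (M₁ * N₀) = M₀ * (1 + T.var (Sum.inl j) * q) := by
        rw [hM₁, ← hq]
        field_simp
        ring
      have h2 : N₁⁻¹ * N₁ = 1 := inv_mul_cancel₀ hN₁0
      have h3 : (T.var (Sum.inl j))⁻¹ * T.var (Sum.inl j) = 1 := inv_mul_cancel₀ hxj0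
      linear_combination (-(T.var (Sum.inl j))⁻¹) * h1 - (T.var (Sum.inl j))⁻¹ * N₀ * h2 -
        M₀ * q * h3
    rw [hfinal]
    exact sub_mem (mul_mem (mul_mem hN₀A hN₁inv) (hAmem _)) (mul_mem hM₀A hqA)
  have hzP : z ∈ A.locAway (T.exchange i) hPA := by
    refine mem_of_mem_laurentSubalgebra_of_mem_update hT (Sum.inl j)
      (exchange_mem_laurentSubalgebraCompl hB j) (exchange_ne_zero hT j) hz hzj ?_
      (Subalgebra.le_locAway hPA hxj) (Subalgebra.le_locAway hPA hxj')
    refine laurentSubalgebra_le_iff.2 fun ⟨k, hkj⟩ => ⟨Subalgebra.le_locAway hPA (h0mem k), ?_⟩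
    by_cases hki : k = Sum.inl i
    · refine ⟨1, ?_⟩
      subst hki
      rw [pow_one, mul_comm, ← mutate_var_self]
      exact h1mem _ habne
    · exact Subalgebra.le_locAway hPA (h0inv k hki hkj)
  have hzQ : z ∈ A.locAway Q hQA := by
    refine (laurentSubalgebra_le_iff.2 fun k => ?_ : (T.mutate i).laurentRing K ≤ _) hzi
    by_cases hkj : k = Sum.inl j
    · subst hkj
      rw [mutate_var_of_ne _ habne.symm]
      refine ⟨Subalgebra.le_locAway hQA hxj, 1, ?_⟩
      rw [pow_one, mul_comm, ← hyx]
      exact hAmem _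
    · exact ⟨Subalgebra.le_locAway hQA (h1mem k hkj), Subalgebra.le_locAway hQA (h1inv k hkj)⟩
  refine Subalgebra.mem_of_mem_locAway ⟨N⁻¹, hNinv, -(N⁻¹ * G * y⁻¹),
    neg_mem (mul_mem (mul_mem hNinv hGA) (hAinv _)), ?_⟩ hzP hzQ
  rw [hG]
  have h1 : N⁻¹ * N = 1 := inv_mul_cancel₀ hN0
  linear_combination h1 + N⁻¹ * G * hxjQ

/-- The rank two step when `b_ji = 0`: here the two exchange polynomials have to be relatively prime,
which is guaranteed by the linear independence of the columns of the exchange matrix. -/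
theorem mem_laurentRing_mutate_mutate_of_eq_zero [IsDomain K] [UniqueFactorizationMonoid K]
    [CharZero K] {T : SeedData F ι κ}
    (hT : AlgebraicIndependent K T.var) (hB : IsExchangeMatrix T.B)
    (hli : LinearIndependent ℤ fun k j => T.B j k) {i j : ι} (hij : i ≠ j)
    (h0 : T.B (Sum.inl j) i = 0) {z : F}
    (hzi : z ∈ (T.mutate i).laurentRing K) (hzj : z ∈ (T.mutate j).laurentRing K) :
    z ∈ ((T.mutate i).mutate j).laurentRing K := by
  have h0' := hB.apply_eq_zero h0
  have hT1 := algebraicIndependent_mutate hT hB i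
  have hB1 : IsExchangeMatrix (T.mutate i).B := hB.mutateMatrix i
  have hT2 := algebraicIndependent_mutate hT1 hB1 j
  have habne : (Sum.inl i : ι ⊕ κ) ≠ Sum.inl j := by simpa using hij
  set U := (T.mutate i).mutate j with hU
  set A := U.laurentRing K
  have hAmem (k : ι ⊕ κ) : U.var k ∈ A := mem_laurentSubalgebra (K := K) U.var k
  have hAinv (k : ι ⊕ κ) : (U.var k)⁻¹ ∈ A := inv_mem_laurentSubalgebra (K := K) U.var k
  have hUvar (k : ι ⊕ κ) (hki : k ≠ Sum.inl i) (hkj : k ≠ Sum.inl j) : U.var k = T.var k := by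
    rw [hU, mutate_var_of_ne _ hkj, mutate_var_of_ne _ hki]
  have hcol (k : ι ⊕ κ) : (T.mutate i).B k j = T.B k j := by
    by_cases hk : k = Sum.inl i
    · subst hk
      rw [mutate_B, mutateMatrix_apply_of_eq _ (Or.inl rfl), h0', neg_zero]
    · rw [mutate_B, mutateMatrix_apply_of_ne _ hk hij.symm, h0']
      simp
  have hexchj : (T.mutate i).exchange j = T.exchange j := by
    refine exchange_congr hcol fun k => ?_
    by_cases hk : k = Sum.inl i
    · exact Or.inl (by rw [hcol, hk, h0'])
    · exact Or.inr (mutate_var_of_ne T hk)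
  have hPi : T.exchange i = aeval U.var (exchangePolynomial K fun k => T.B k i) := by
    refine Eq.trans (b := (⟨U.var, T.B⟩ : SeedData F ι κ).exchange i) ?_ (exchange_eq_aeval _ i)
    refine exchange_congr (fun _ => rfl) fun k => ?_
    by_cases hki : k = Sum.inl i
    · exact Or.inl (by rw [hki, hB.apply_self])
    by_cases hkj : k = Sum.inl j
    · exact Or.inl (by rw [hkj, h0])
    · exact Or.inr (hUvar k hki hkj).symm
  have hPj : T.exchange j = aeval U.var (exchangePolynomial K fun k => T.B k j) := by
    refine Eq.trans (b := (⟨U.var, T.B⟩ : SeedData F ι κ).exchange j) ?_ (exchange_eq_aeval _ j)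
    refine exchange_congr (fun _ => rfl) fun k => ?_
    by_cases hki : k = Sum.inl i
    · exact Or.inl (by rw [hki, h0'])
    by_cases hkj : k = Sum.inl j
    · exact Or.inl (by rw [hkj, hB.apply_self])
    · exact Or.inr (hUvar k hki hkj).symm
  have hPiA : T.exchange i ∈ A := by
    rw [hPi]
    exact aeval_mem_laurentSubalgebra _ _
  have hPjA : T.exchange j ∈ A := by
    rw [hPj]
    exact aeval_mem_laurentSubalgebra _ _
  have hvari : U.var (Sum.inl i) = (T.var (Sum.inl i))⁻¹ * T.exchange i := by
    rw [hU, mutate_var_of_ne _ habne, mutate_var_self]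
  have hvarj : U.var (Sum.inl j) = (T.var (Sum.inl j))⁻¹ * T.exchange j := by
    rw [hU, mutate_var_self, hexchj, mutate_var_of_ne _ habne.symm]
  -- a variable `x` with `x'' = x⁻¹ * P` and its inverse acquire only powers of `P` as denominators
  have hloc {P x x'' : F} (hP : P ∈ A) (hP0 : P ≠ 0) (hx'' : x'' ∈ A) (hinv : x''⁻¹ ∈ A)
      (h : x'' = x⁻¹ * P) : x ∈ A.locAway P hP ∧ x⁻¹ ∈ A.locAway P hP := by
    have hx : x = x''⁻¹ * P := by
      rw [h, mul_inv, inv_inv, mul_assoc, inv_mul_cancel₀ hP0, mul_one]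
    refine ⟨Subalgebra.le_locAway hP ?_, 1, ?_⟩
    · rw [hx]
      exact mul_mem hinv hP
    · rwa [pow_one, mul_comm, ← h]
  have hzP : z ∈ A.locAway (T.exchange i) hPiA := by
    refine (laurentSubalgebra_le_iff.2 fun k => ?_ : (T.mutate j).laurentRing K ≤ _) hzj
    by_cases hkj : k = Sum.inl j
    · subst hkj
      rw [mutate_var_self, ← hvarj]
      exact ⟨Subalgebra.le_locAway _ (hAmem _), Subalgebra.le_locAway _ (hAinv _)⟩
    rw [mutate_var_of_ne _ hkj]
    by_cases hki : k = Sum.inl i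
    · subst hki
      exact hloc hPiA (exchange_ne_zero hT i) (hAmem _) (hAinv _) hvari
    · rw [← hUvar k hki hkj]
      exact ⟨Subalgebra.le_locAway _ (hAmem _), Subalgebra.le_locAway _ (hAinv _)⟩
  have hzQ : z ∈ A.locAway (T.exchange j) hPjA := by
    refine (laurentSubalgebra_le_iff.2 fun k => ?_ : (T.mutate i).laurentRing K ≤ _) hzi
    by_cases hkj : k = Sum.inl j
    · subst hkj
      rw [mutate_var_of_ne _ habne.symm]
      exact hloc hPjA (exchange_ne_zero hT j) (hAmem _) (hAinv _) hvarj
    · rw [← mutate_var_of_ne (T.mutate i) hkj, ← hU]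
      exact ⟨Subalgebra.le_locAway _ (hAmem _), Subalgebra.le_locAway _ (hAinv _)⟩
  obtain ⟨M, hM⟩ := hzP
  obtain ⟨N, hN⟩ := hzQ
  obtain ⟨ℓ, hℓi, hℓj⟩ := exists_weight_of_linearIndependent hli hij
  rw [hPi] at hM
  rw [hPj] at hN
  exact mem_laurentSubalgebra_of_isRelPrime hT2
    (isRelPrime_exchangePolynomial hℓi hℓj (exchangePolynomial_ne_zero _))
    (exchangePolynomial_ne_zero _) hM hN

end SeedData

/-! ### Upper bounds of seeds in general position -/

namespace SeedData

section UpperBound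

variable {K F ι κ : Type*} [CommRing K] [Field F] [Algebra K F]
  [Fintype ι] [Fintype κ] [DecidableEq ι] [DecidableEq κ]

/-- The upper bound of a seed: the elements that are Laurent polynomials in the seed itself and in each of
the seeds obtained from it by a single mutation. -/
noncomputable def upperBound (K : Type*) [CommRing K] [Algebra K F] (T : SeedData F ι κ) : Subalgebra K F :=
  T.laurentRing K ⊓ ⨅ i, (T.mutate i).laurentRing K

theorem mem_upperBound {T : SeedData F ι κ} {z : F} : z ∈ T.upperBound K ↔
    z ∈ T.laurentRing K ∧ ∀ i, z ∈ (T.mutate i).laurentRing K := by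
  rw [upperBound, Algebra.mem_inf, Algebra.mem_iInf]

/-- A seed in general position: the variables are algebraically independent, and the exchange matrix has
linearly independent columns. -/
structure IsGeneric (K : Type*) [CommRing K] [Algebra K F] (T : SeedData F ι κ) : Prop where
  algebraicIndependent : AlgebraicIndependent K T.var
  isExchangeMatrix : IsExchangeMatrix T.B
  linearIndependent : LinearIndependent ℤ fun k j => T.B j k

theorem IsGeneric.mutate [IsDomain K] [CharZero K] {T : SeedData F ι κ} (hT : T.IsGeneric K) (i : ι) :
    (T.mutate i).IsGeneric K where
  algebraicIndependent := algebraicIndependent_mutate hT.1 hT.2 i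
  isExchangeMatrix := hT.2.mutateMatrix i
  linearIndependent := linearIndependent_col_mutateMatrix hT.2 hT.3 i

theorem var_mem_upperBound [CharZero K] {T : SeedData F ι κ} (hT : AlgebraicIndependent K T.var)
    (hB : IsExchangeMatrix T.B) (k : ι ⊕ κ) : T.var k ∈ T.upperBound K := by
  refine mem_upperBound.2 ⟨mem_laurentSubalgebra T.var k, fun i => ?_⟩
  have hmem (l : ι ⊕ κ) : (T.mutate i).var l ∈ (T.mutate i).laurentRing K :=
    mem_laurentSubalgebra (T.mutate i).var l
  by_cases hk : k = Sum.inl i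
  · subst hk
    have h : T.var (Sum.inl i) = ((T.mutate i).var (Sum.inl i))⁻¹ * T.exchange i := by
      rw [mutate_var_self, mul_inv, inv_inv, mul_assoc, inv_mul_cancel₀ (exchange_ne_zero hT i),
        mul_one]
    rw [h]
    refine mul_mem (inv_mem_laurentSubalgebra (T.mutate i).var _) (exchange_mem fun l => ?_)
    by_cases hl : l = Sum.inl i
    · exact Or.inl (by rw [hl, hB.apply_self])
    · rw [← mutate_var_of_ne T hl]
      exact Or.inr (hmem l)
  · rw [← mutate_var_of_ne T hk]
    exact hmem k

variable [IsDomain K] [CharZero K] [UniqueFactorizationMonoid K]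

theorem mem_laurentRing_mutate_mutate {T : SeedData F ι κ} (hT : T.IsGeneric K) {i j : ι}
    (hij : i ≠ j) {z : F} (hz : z ∈ T.upperBound K) :
    z ∈ ((T.mutate i).mutate j).laurentRing K := by
  obtain ⟨h0, h⟩ := mem_upperBound.1 hz
  rcases lt_trichotomy (T.B (Sum.inl j) i) 0 with hneg | hzero | hpos
  · have h1 : z ∈ ((T.opposite.mutate i).mutate j).laurentRing K := by
      refine mem_laurentRing_mutate_mutate_of_pos (T := T.opposite) hT.1 hT.2.neg hij
        (by simpa [opposite] using hneg) h0 ?_ ?_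
      · rw [opposite_mutate]
        exact h i
      · rw [opposite_mutate]
        exact h j
    rwa [opposite_mutate, opposite_mutate] at h1
  · exact mem_laurentRing_mutate_mutate_of_eq_zero hT.1 hT.2 hT.3 hij hzero (h i) (h j)
  · exact mem_laurentRing_mutate_mutate_of_pos hT.1 hT.2 hij hpos h0 (h i) (h j)

theorem upperBound_le_upperBound_mutate {T : SeedData F ι κ} (hT : T.IsGeneric K) (i : ι) :
    T.upperBound K ≤ (T.mutate i).upperBound K := by
  intro z hz
  refine mem_upperBound.2 ⟨(mem_upperBound.1 hz).2 i, fun j => ?_⟩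
  by_cases hij : i = j
  · subst hij
    rw [mutate_mutate hT.1 hT.2]
    exact (mem_upperBound.1 hz).1
  · exact mem_laurentRing_mutate_mutate hT hij hz

theorem upperBound_mutate {T : SeedData F ι κ} (hT : T.IsGeneric K) (i : ι) :
    (T.mutate i).upperBound K = T.upperBound K := by
  refine le_antisymm ?_ (upperBound_le_upperBound_mutate hT i)
  have h := upperBound_le_upperBound_mutate (hT.mutate i) i
  rwa [mutate_mutate hT.1 hT.2] at h

/-- The Laurent phenomenon for seeds in general position. -/
theorem IsGeneric.var_mem_laurentRing {S T : SeedData F ι κ} (hS : S.IsGeneric K)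
    (h : S.MutationEquiv T) (k : ι ⊕ κ) : T.var k ∈ S.laurentRing K := by
  have key : T.IsGeneric K ∧ T.upperBound K = S.upperBound K := by
    induction h with
    | refl => exact ⟨hS, rfl⟩
    | mutate T i _ ih => exact ⟨ih.1.mutate i, (upperBound_mutate ih.1 i).trans ih.2⟩
  have := var_mem_upperBound key.1.1 key.1.2 k
  rw [key.2] at this
  exact (mem_upperBound.1 this).1

end UpperBound

end SeedData

/-! ### Specialization of fractions -/

section Specialization

variable {R F' F : Type*} [CommRing R] [Field F'] [Algebra R F'] [Field F] {φ : R →+* F}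

/-- The element `z` of the fraction field of `R` specializes to `w` under `φ : R →+* F`: it is a fraction
whose denominator does not vanish under `φ` and whose image is `w`. -/
def SpecializesTo (φ : R →+* F) (z : F') (w : F) : Prop :=
  ∃ f g : R, φ g ≠ 0 ∧ z * algebraMap R F' g = algebraMap R F' f ∧ w * φ g = φ f

namespace SpecializesTo

theorem of_algebraMap (φ : R →+* F) (r : R) : SpecializesTo φ (algebraMap R F' r) (φ r) :=
  ⟨r, 1, by simp, by simp, by simp⟩

theorem add {z z' : F'} {w w' : F} (h : SpecializesTo φ z w) (h' : SpecializesTo φ z' w') :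
    SpecializesTo φ (z + z') (w + w') := by
  obtain ⟨f, g, hg, h1, h2⟩ := h
  obtain ⟨f', g', hg', h1', h2'⟩ := h'
  refine ⟨f * g' + f' * g, g * g', by simp [hg, hg'], ?_, ?_⟩
  · simp only [map_add, map_mul, ← h1, ← h1']
    ring
  · simp only [map_add, map_mul, ← h2, ← h2']
    ring

theorem mul {z z' : F'} {w w' : F} (h : SpecializesTo φ z w) (h' : SpecializesTo φ z' w') :
    SpecializesTo φ (z * z') (w * w') := by
  obtain ⟨f, g, hg, h1, h2⟩ := h
  obtain ⟨f', g', hg', h1', h2'⟩ := h'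
  refine ⟨f * f', g * g', by simp [hg, hg'], ?_, ?_⟩
  · simp only [map_mul, ← h1, ← h1']
    ring
  · simp only [map_mul, ← h2, ← h2']
    ring

theorem one : SpecializesTo φ (1 : F') (1 : F) := by
  simpa using of_algebraMap (F' := F') φ 1

theorem pow {z : F'} {w : F} (h : SpecializesTo φ z w) (n : ℕ) :
    SpecializesTo φ (z ^ n) (w ^ n) := by
  induction n with
  | zero => simpa using one
  | succ n ih => simpa only [pow_succ] using ih.mul h

theorem prod {σ : Type*} {s : Finset σ} {z : σ → F'} {w : σ → F}
    (h : ∀ k ∈ s, SpecializesTo φ (z k) (w k)) :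
    SpecializesTo φ (∏ k ∈ s, z k) (∏ k ∈ s, w k) := by
  classical
  induction s using Finset.induction_on with
  | empty => simpa using one
  | insert a s ha ih =>
    rw [Finset.prod_insert ha, Finset.prod_insert ha]
    exact (h a (Finset.mem_insert_self a s)).mul
      (ih fun k hk => h k (Finset.mem_insert_of_mem hk))

theorem inv [IsFractionRing R F'] {z : F'} {w : F} (h : SpecializesTo φ z w) (hw : w ≠ 0) :
    SpecializesTo φ z⁻¹ w⁻¹ := by
  obtain ⟨f, g, hg, h1, h2⟩ := h
  have hf : φ f ≠ 0 := h2 ▸ mul_ne_zero hw hg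
  have hf' : algebraMap R F' f ≠ 0 := by
    rw [Ne, IsFractionRing.to_map_eq_zero_iff]
    rintro rfl
    exact hf (map_zero φ)
  have hz : z ≠ 0 := by
    rintro rfl
    exact hf' (by rw [← h1, zero_mul])
  exact ⟨g, f, hf, by rw [← h1, inv_mul_cancel_left₀ hz], by rw [← h2, inv_mul_cancel_left₀ hw]⟩

/-- Every representation as a fraction computes the specialization, as long as its denominator does not
vanish. -/
theorem mul_eq [IsFractionRing R F'] {z : F'} {w : F} (h : SpecializesTo φ z w) {f g : R}
    (hz : z * algebraMap R F' g = algebraMap R F' f) : w * φ g = φ f := by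
  obtain ⟨f', g', hg', h1, h2⟩ := h
  have key : f' * g = f * g' := by
    apply IsFractionRing.injective R F'
    rw [map_mul, map_mul, ← h1, ← hz]
    ring
  have key' := congrArg φ key
  rw [map_mul, map_mul, ← h2] at key'
  apply mul_right_cancel₀ hg'
  linear_combination key'

end SpecializesTo

end Specialization

/-! ### Principal coefficients and the Laurent phenomenon for all seeds -/

namespace SeedData

section PrincipalExtension

variable {K F ι κ : Type*} [CommRing K] [IsDomain K] [DecidableEq ι]

/-- The seed with principal coefficients added: there is one more frozen variable for each exchangeable
index, and the identity matrix is placed below `S.B`. The ambient field is the field of rational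
functions in all these variables. -/
noncomputable def principalExtension (K : Type*) [CommRing K] [IsDomain K]
    (S : SeedData F ι κ) :
    SeedData (FractionRing (MvPolynomial (ι ⊕ (κ ⊕ ι)) K)) ι (κ ⊕ ι) where
  var k := algebraMap (MvPolynomial (ι ⊕ (κ ⊕ ι)) K) _ (X k)
  B := Sum.elim (fun i => S.B (Sum.inl i))
    (Sum.elim (fun k => S.B (Sum.inr k)) fun l j => if l = j then 1 else 0)

theorem aeval_principalExtension_var (S : SeedData F ι κ)
    (f : MvPolynomial (ι ⊕ (κ ⊕ ι)) K) :
    aeval (S.principalExtension K).var f =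
      algebraMap _ (FractionRing (MvPolynomial (ι ⊕ (κ ⊕ ι)) K)) f := by
  induction f using MvPolynomial.induction_on with
  | C a =>
    rw [algHom_C]
    exact IsScalarTower.algebraMap_apply K (MvPolynomial (ι ⊕ (κ ⊕ ι)) K) _ a
  | add p q hp hq => rw [map_add, map_add, hp, hq]
  | mul_X p k hp =>
    rw [map_mul, map_mul, hp, aeval_X]
    rfl

theorem isGeneric_principalExtension [Fintype ι] (S : SeedData F ι κ) (hB : IsExchangeMatrix S.B) :
    (S.principalExtension K).IsGeneric K where
  algebraicIndependent := by
    intro f g hfg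
    rw [aeval_principalExtension_var, aeval_principalExtension_var] at hfg
    exact IsFractionRing.injective _ _ hfg
  isExchangeMatrix := hB
  linearIndependent := by
    rw [Fintype.linearIndependent_iff]
    intro c hc l
    have := congrFun hc (Sum.inr (Sum.inr l))
    simpa [principalExtension] using this

end PrincipalExtension

variable {K F ι κ : Type*} [CommRing K] [Field F] [Algebra K F]
  [Fintype ι] [Fintype κ] [DecidableEq ι] [DecidableEq κ]

theorem MutationEquiv.trans {S T U : SeedData F ι κ} (h : S.MutationEquiv T)
    (h' : T.MutationEquiv U) : S.MutationEquiv U := by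
  induction h' with
  | refl => exact h
  | mutate U i _ ih => exact .mutate U i ih

theorem MutationEquiv.var_inr {S T : SeedData F ι κ} (h : S.MutationEquiv T) (k : κ) :
    T.var (Sum.inr k) = S.var (Sum.inr k) := by
  induction h with
  | refl => rfl
  | mutate T i _ ih => rw [mutate_var_of_ne T (by simp), ih]

theorem mem_upperClusterAlgebra {S : SeedData F ι κ} {z : F} :
    z ∈ S.upperClusterAlgebra K ↔
      ∀ T : SeedData F ι κ, S.MutationEquiv T → z ∈ T.laurentRing K := by
  simp only [upperClusterAlgebra, Algebra.mem_iInf]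

theorem upperClusterAlgebra_le_upperBound (S : SeedData F ι κ) :
    S.upperClusterAlgebra K ≤ S.upperBound K := fun _ hz =>
  mem_upperBound.2 ⟨mem_upperClusterAlgebra.1 hz S .refl,
    fun i => mem_upperClusterAlgebra.1 hz _ (.mutate S i .refl)⟩

/-- The variables of a seed, with the value `1` for each additional frozen variable. -/
def extendByOne (T : SeedData F ι κ) : ι ⊕ (κ ⊕ ι) → F :=
  Sum.elim (fun i => T.var (Sum.inl i)) (Sum.elim (fun k => T.var (Sum.inr k)) fun _ => 1)

variable [IsDomain K] [CharZero K]

theorem MutationEquiv.algebraicIndependent_and_isExchangeMatrix {S T : SeedData F ι κ}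
    (h : S.MutationEquiv T) (hS : AlgebraicIndependent K S.var) (hB : IsExchangeMatrix S.B) :
    AlgebraicIndependent K T.var ∧ IsExchangeMatrix T.B := by
  induction h with
  | refl => exact ⟨hS, hB⟩
  | mutate T i _ ih => exact ⟨algebraicIndependent_mutate ih.1 ih.2 i, ih.2.mutateMatrix i⟩

theorem MutationEquiv.symm {S T : SeedData F ι κ} (h : S.MutationEquiv T)
    (hS : AlgebraicIndependent K S.var) (hB : IsExchangeMatrix S.B) : T.MutationEquiv S := by
  induction h with
  | refl => exact .refl
  | mutate T i hST ih =>
    have hT := hST.algebraicIndependent_and_isExchangeMatrix hS hB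
    have h1 : (T.mutate i).MutationEquiv ((T.mutate i).mutate i) := .mutate _ i .refl
    rw [mutate_mutate hT.1 hT.2] at h1
    exact h1.trans ih

/-- Setting the additional frozen variables to `1` maps the seeds that are mutation-equivalent to the
principal extension of `S` to the seeds mutation-equivalent to `S`. -/
theorem MutationEquiv.exists_principalExtension {S T : SeedData F ι κ} (h : S.MutationEquiv T)
    (hS : AlgebraicIndependent K S.var) (hB : IsExchangeMatrix S.B) :
    ∃ T' : SeedData (FractionRing (MvPolynomial (ι ⊕ (κ ⊕ ι)) K)) ι (κ ⊕ ι),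
      (S.principalExtension K).MutationEquiv T' ∧
      (∀ k, SpecializesTo (aeval (R := K) S.extendByOne).toRingHom (T'.var k) (T.extendByOne k)) ∧
      (∀ i j, T'.B (Sum.inl i) j = T.B (Sum.inl i) j) ∧
      ∀ k j, T'.B (Sum.inr (Sum.inl k)) j = T.B (Sum.inr k) j := by
  induction h with
  | refl =>
    refine ⟨_, .refl, fun k => ?_, fun _ _ => rfl, fun _ _ => rfl⟩
    have := SpecializesTo.of_algebraMap
      (F' := FractionRing (MvPolynomial (ι ⊕ (κ ⊕ ι)) K))
      (aeval (R := K) S.extendByOne).toRingHom (X k)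
    rw [AlgHom.toRingHom_eq_coe, RingHom.coe_coe, aeval_X] at this
    exact this
  | mutate T i hST ih =>
    obtain ⟨T', hT', hvar, hBl, hBr⟩ := ih
    have hT := (hST.algebraicIndependent_and_isExchangeMatrix hS hB).1
    refine ⟨T'.mutate i, .mutate T' i hT', fun k => ?_, fun j k => ?_, fun j k => ?_⟩
    · have hexch : SpecializesTo (aeval (R := K) S.extendByOne).toRingHom
          (T'.exchange i) (T.exchange i) := by
        have h1 : T.exchange i = (∏ k, T.extendByOne k ^ (T'.B k i).toNat) +
            ∏ k, T.extendByOne k ^ (-(T'.B k i)).toNat := by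
          simp [exchange, Fintype.prod_sum_type, extendByOne, hBl, hBr]
        rw [h1]
        exact (SpecializesTo.prod fun k _ => (hvar k).pow _).add
          (SpecializesTo.prod fun k _ => (hvar k).pow _)
      by_cases hk : k = Sum.inl i
      · subst hk
        rw [mutate_var_self]
        have h1 : (T.mutate i).extendByOne (Sum.inl i) =
            (T.var (Sum.inl i))⁻¹ * T.exchange i := mutate_var_self T i
        rw [h1]
        exact ((hvar (Sum.inl i)).inv (hT.ne_zero _)).mul hexch
      · rw [mutate_var_of_ne _ hk]
        have h1 : (T.mutate i).extendByOne k = T.extendByOne k := by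
          rcases k with k | k | k
          · exact mutate_var_of_ne T (by simpa using hk)
          · exact mutate_var_of_ne T (by simp)
          · rfl
        rw [h1]
        exact hvar k
    · simp only [mutate_B, mutateMatrix, hBl, Sum.inl.injEq]
    · simp only [mutate_B, mutateMatrix, hBl, hBr, reduceCtorEq]

variable [UniqueFactorizationMonoid K]

/-- The Laurent phenomenon: the variables of all mutation-equivalent seeds are Laurent polynomials in the
variables of the given seed. -/
theorem MutationEquiv.var_mem_laurentRing {S T : SeedData F ι κ} (h : S.MutationEquiv T)
    (hS : AlgebraicIndependent K S.var) (hB : IsExchangeMatrix S.B) (k : ι ⊕ κ) :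
    T.var k ∈ S.laurentRing K := by
  obtain ⟨T', hT', hvar, -, -⟩ := h.exists_principalExtension hS hB
  have hgen := S.isGeneric_principalExtension (K := K) hB
  set k' : ι ⊕ (κ ⊕ ι) := Sum.map id Sum.inl k
  have hk' : T.extendByOne k' = T.var k := by
    rcases k with k | k <;> rfl
  obtain ⟨d, f, hf⟩ := (mem_laurentSubalgebra_iff hgen.1.ne_zero).1
    (hgen.var_mem_laurentRing hT' k')
  rw [aeval_principalExtension_var, aeval_principalExtension_var] at hf
  have hsp := (hvar k').mul_eq hf
  rw [hk'] at hsp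
  have hne : ∀ l, S.extendByOne l ≠ 0 := by
    rintro (l | l | l)
    exacts [hS.ne_zero _, hS.ne_zero _, one_ne_zero]
  have hmem : T.var k ∈ laurentSubalgebra K S.extendByOne :=
    (mem_laurentSubalgebra_iff hne).2 ⟨d, f, hsp⟩
  have hle : laurentSubalgebra K S.extendByOne ≤ S.laurentRing K := by
    refine laurentSubalgebra_le_iff.2 ?_
    rintro (l | l | l)
    · exact ⟨mem_laurentSubalgebra S.var _, inv_mem_laurentSubalgebra S.var _⟩
    · exact ⟨mem_laurentSubalgebra S.var _, inv_mem_laurentSubalgebra S.var _⟩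
    · simp [extendByOne]
  exact hle hmem

theorem clusterAlgebra_le_upperClusterAlgebra {S : SeedData F ι κ}
    (hS : AlgebraicIndependent K S.var) (hB : IsExchangeMatrix S.B) :
    S.clusterAlgebra K ≤ S.upperClusterAlgebra K := by
  intro z hz
  refine mem_upperClusterAlgebra.2 fun U hU => ?_
  refine (Algebra.adjoin_le ?_ : S.clusterAlgebra K ≤ U.laurentRing K) hz
  have hU' := hU.algebraicIndependent_and_isExchangeMatrix hS hB
  rintro _ ((⟨T, hT, i, rfl⟩ | ⟨k, rfl⟩) | ⟨k, rfl⟩)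
  · exact ((hU.symm hS hB).trans hT).var_mem_laurentRing hU'.1 hU'.2 _
  · change S.var (Sum.inr k) ∈ _
    rw [← hU.var_inr k]
    exact mem_laurentSubalgebra U.var _
  · change (S.var (Sum.inr k))⁻¹ ∈ _
    rw [← hU.var_inr k]
    exact inv_mem_laurentSubalgebra U.var _

end SeedData

/-! ### Finite factorization from finitely many divisors -/

section FiniteFactorization

variable {A : Type*} [CommRing A]

/-- A domain in which every nonzero element has finitely many divisors up to associates is a finite
factorization domain. The number of divisor classes strictly increases under multiplication by a
non-unit, so it bounds the lengths of factorizations. -/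
theorem isFFDomain_of_finite_divisors [IsDomain A]
    (h : ∀ a : A, a ≠ 0 → {d : Associates A | d ∣ Associates.mk a}.Finite) : IsFFDomain A := by
  have hlt {a b : A} (hb : b ≠ 0) (hab : DvdNotUnit a b) :
      {d : Associates A | d ∣ Associates.mk a}.ncard <
        {d : Associates A | d ∣ Associates.mk b}.ncard := by
    refine Set.ncard_lt_ncard ⟨fun d hd => hd.trans ?_, fun hsub => ?_⟩ (h b hb)
    · exact Associates.mk_dvd_mk.2 (dvd_and_not_dvd_iff.2 hab).1
    · have h1 : Associates.mk b ∣ Associates.mk a := hsub (dvd_refl (Associates.mk b))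
      exact (dvd_and_not_dvd_iff.2 hab).2 (Associates.mk_dvd_mk.1 h1)
  have hwf : WfDvdMonoid A := by
    refine ⟨⟨fun b => ?_⟩⟩
    have key : ∀ (n : ℕ) (b : A), b ≠ 0 → {d : Associates A | d ∣ Associates.mk b}.ncard ≤ n →
        Acc DvdNotUnit b := by
      intro n
      induction n with
      | zero =>
        refine fun b hb hn => ⟨b, fun a hab => ?_⟩
        have := hlt hb hab
        omega
      | succ n ih =>
        exact fun b hb hn => ⟨b, fun a hab => ih a hab.1 (by have := hlt hb hab; omega)⟩
    by_cases hb : b = 0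
    · exact ⟨b, fun a hab => key _ a hab.1 le_rfl⟩
    · exact key _ b hb le_rfl
  have hlen : ∀ s : Multiset A, (∀ u ∈ s, Irreducible u) →
      s.card ≤ {d : Associates A | d ∣ Associates.mk s.prod}.ncard := by
    intro s
    induction s using Multiset.induction_on with
    | empty => simp
    | cons u s ih =>
      intro hs
      have hs0 : s.prod ≠ 0 := Multiset.prod_ne_zero fun h0 =>
        (hs 0 (Multiset.mem_cons_of_mem h0)).ne_zero rfl
      have hu := hs u (Multiset.mem_cons_self u s)
      have h1 := ih fun v hv => hs v (Multiset.mem_cons_of_mem hv)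
      have h2 := hlt (a := s.prod) (b := (u ::ₘ s).prod)
        (by rw [Multiset.prod_cons]; exact mul_ne_zero hu.ne_zero hs0)
        ⟨hs0, u, hu.not_isUnit, by rw [Multiset.prod_cons, mul_comm]⟩
      rw [Multiset.card_cons]
      omega
  refine ⟨⟨inferInstance, fun a ha hau => ?_⟩, fun a ha _ => ?_⟩
  · obtain ⟨s, hs, hprod, -⟩ := (WfDvdMonoid.not_isUnit_iff_exists_factors_eq a ha).1 hau
    exact ⟨s, hs, hprod⟩
  · -- all factorizations are submultisets of one finite multiset of divisor classes
    have hfin := h a ha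
    classical
    set N := {d : Associates A | d ∣ Associates.mk a}.ncard
    refine (Set.finite_Iic (N • hfin.toFinset.val)).subset ?_
    rintro _ ⟨s, ⟨hs, rfl⟩, rfl⟩
    refine Multiset.le_iff_count.2 fun d => ?_
    by_cases hd : d ∈ s.map Associates.mk
    · obtain ⟨u, hu, rfl⟩ := Multiset.mem_map.1 hd
      have hmem : Associates.mk u ∈ hfin.toFinset.val := by
        simpa using Multiset.dvd_prod hu
      rw [Multiset.count_nsmul, Multiset.count_eq_one_of_mem hfin.toFinset.nodup hmem, mul_one]
      refine (Multiset.count_le_card _ _).trans ?_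
      rw [Multiset.card_map]
      exact hlen s hs
    · rw [Multiset.count_eq_zero_of_notMem hd]
      exact Nat.zero_le _

theorem IsFFDomain.isBFDomain (h : IsFFDomain A) : IsBFDomain A := by
  refine ⟨h.isAtomicDomain, fun a ha hau => ?_⟩
  obtain ⟨N, hN⟩ := ((h.finite_factorizations a ha hau).image Multiset.card).bddAbove
  refine ⟨N, fun s hs => ?_⟩
  have := hN ⟨_, ⟨s, hs, rfl⟩, rfl⟩
  rwa [Multiset.card_map] at this

end FiniteFactorization

/-! ### Divisors in Laurent polynomial rings -/

section Bound

variable {K F σ : Type*} [CommRing K] [Field F] [Algebra K F]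

theorem exists_bound_of_inv_notMem {A : Subalgebra K F} [IsNoetherianRing A] {p : F}
    (hp : p ∈ A) (hpinv : p⁻¹ ∉ A) {w : F} (hw : w ∈ A) (hw0 : w ≠ 0) :
    ∃ N : ℕ, ∀ n : ℕ, w * (p ^ n)⁻¹ ∈ A → n ≤ N := by
  by_cases hp0 : p = 0
  · exact absurd (by rw [hp0, inv_zero]; exact zero_mem A) hpinv
  have hunit : ¬ IsUnit (⟨p, hp⟩ : A) := by
    rintro ⟨u, hu⟩
    apply hpinv
    have h1 : ((u : A) : F) * ((u⁻¹ : Aˣ) : A) = 1 := congrArg Subtype.val u.mul_inv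
    rw [hu] at h1
    rw [inv_eq_of_mul_eq_one_right h1]
    exact Subtype.property _
  have hne : (⟨w, hw⟩ : A) ≠ 0 := fun h => hw0 (congrArg Subtype.val h)
  obtain ⟨N, hN⟩ := FiniteMultiplicity.of_not_isUnit hunit hne
  refine ⟨N, fun n hn => ?_⟩
  by_contra hlt
  refine hN ((pow_dvd_pow _ (not_le.1 hlt)).trans ⟨⟨_, hn⟩, Subtype.ext ?_⟩)
  change w = p ^ n * (w * (p ^ n)⁻¹)
  rw [mul_left_comm, mul_inv_cancel₀ (pow_ne_zero n hp0), mul_one]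

theorem isNoetherianRing_laurentSubalgebra [Finite σ] [IsNoetherianRing K] (x : σ → F) :
    IsNoetherianRing (laurentSubalgebra K x) :=
  isNoetherianRing_of_fg (Subalgebra.fg_def.2
    ⟨_, (Set.finite_range x).union (Set.finite_range fun k => (x k)⁻¹), rfl⟩)

theorem zpow_mem_of_mem_of_inv_mem {A : Subalgebra K F} {x : F} (h : x ∈ A) (h' : x⁻¹ ∈ A)
    (n : ℤ) : x ^ n ∈ A := by
  cases n with
  | ofNat n => simpa using pow_mem h n
  | negSucc n =>
    rw [zpow_negSucc, ← inv_pow]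
    exact pow_mem h' _

variable [Fintype σ]

/-- Each divisor of a Laurent polynomial `f / x ^ d` is the product of a unit of `K`, a Laurent monomial,
and the chosen representative of one of the finitely many divisor classes of `f`. -/
theorem exists_eq_mul_aeval_out [IsDomain K] {x : σ → F} (hx : AlgebraicIndependent K x)
    {a b c : F} (hb : b ∈ laurentSubalgebra K x) (hc : c ∈ laurentSubalgebra K x)
    (habc : b * c = a) {d : σ →₀ ℕ} {f : MvPolynomial σ K}
    (hf : a * aeval x (monomial d (1 : K)) = aeval x f) :
    ∃ (q : {q : Associates (MvPolynomial σ K) // q ∣ Associates.mk f}) (r : Kˣ) (e : σ → ℤ),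
      b = algebraMap K F r * (∏ k, x k ^ e k) * aeval x (Quot.out q.1) := by
  obtain ⟨m, n, g, hg, h⟩ := exists_dvd_of_mul_eq hx hb hc habc hf
  have hassoc : Associated (Quot.out (Associates.mk g)) g :=
    Associates.mk_eq_mk_iff_associated.1 (Associates.quot_out _)
  obtain ⟨w, hw⟩ := hassoc
  obtain ⟨r, hr, hrw⟩ := isUnit_iff_eq_C_of_isReduced.1 w.isUnit
  refine ⟨⟨Associates.mk g, Associates.mk_dvd_mk.2 hg⟩, hr.unit, fun k => m k - n k, ?_⟩
  have hmon (d : σ →₀ ℕ) : aeval x (monomial d (1 : K)) = ∏ k, x k ^ (d k : ℤ) := by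
    rw [aeval_monomial_one, Finsupp.prod_fintype _ _ (by simp)]
    simp
  have hprod : (∏ k, x k ^ ((m k : ℤ) - n k)) =
      aeval x (monomial m (1 : K)) * (aeval x (monomial n (1 : K)))⁻¹ := by
    rw [hmon, hmon, ← Finset.prod_inv_distrib, ← Finset.prod_mul_distrib]
    exact Finset.prod_congr rfl fun k _ => by rw [zpow_sub₀ (hx.ne_zero k), div_eq_mul_inv]
  have hg' : aeval x g = aeval x (Quot.out (Associates.mk g)) * algebraMap K F r := by
    have := congrArg (aeval x) hw
    rw [map_mul, hrw, algHom_C] at this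
    exact this.symm
  have hn := aeval_monomial_ne_zero (K := K) hx.ne_zero n
  rw [hprod, IsUnit.unit_spec]
  apply mul_right_cancel₀ hn
  rw [h, hg']
  field_simp

end Bound

/-! ### Divisors in algebras between the cluster algebra and the upper bound -/

namespace SeedData

variable {K F ι κ : Type*} [CommRing K] [Field F] [Algebra K F]
  [Fintype ι] [Fintype κ] [DecidableEq ι] [DecidableEq κ]
  [CharZero K]

/-- The exchange polynomial `P` at `i` is not invertible in the Laurent ring of the seed mutated at `i`,
unless `x_i` is invertible in every subalgebra containing the mutated variable `P / x_i`: an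
invertible `P` is a monomial, so the column is zero, and `P = 2`. -/
theorem inv_exchange_notMem_or_inv_var_mem [IsDomain K] {S : SeedData F ι κ}
    (hS : AlgebraicIndependent K S.var) (hB : IsExchangeMatrix S.B) (i : ι) {D : Subalgebra K F}
    (hD : (S.mutate i).var (Sum.inl i) ∈ D) :
    (S.exchange i)⁻¹ ∉ (S.mutate i).laurentRing K ∨ (S.var (Sum.inl i))⁻¹ ∈ D := by
  refine or_iff_not_imp_left.2 fun hinv => ?_
  rw [not_not] at hinv
  have hS' := algebraicIndependent_mutate hS hB i
  have hP0 := exchange_ne_zero hS i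
  obtain ⟨d, f, hf⟩ := (mem_laurentSubalgebra_iff hS'.ne_zero).1 hinv
  have hdvd : exchangePolynomial K (fun k => (S.mutate i).B k i) ∣ monomial d 1 := by
    refine ⟨f, hS' ?_⟩
    rw [map_mul, ← exchange_eq_aeval, mutate_exchange_self hB, ← hf, mul_inv_cancel_left₀ hP0]
  obtain ⟨m, u, -, hu, hm⟩ := dvd_monomial_one_iff_exists.1 hdvd
  have hcol (k : ι ⊕ κ) : (S.mutate i).B k i = -S.B k i :=
    mutateMatrix_apply_of_eq _ (Or.inr rfl)
  rw [exchangePolynomial, prod_X_pow_eq_monomial_toNat, prod_X_pow_eq_monomial_toNat] at hm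
  set p := Finsupp.equivFunOnFinite.symm fun k => ((S.mutate i).B k i).toNat
  set q := Finsupp.equivFunOnFinite.symm fun k => (-(S.mutate i).B k i).toNat
  have hpq : p = q := by
    by_contra hne
    have h1 := congrArg (coeff p) hm
    have h2 := congrArg (coeff q) hm
    simp only [coeff_add, coeff_monomial, if_true, hne, Ne.symm hne, if_false, add_zero,
      zero_add] at h1 h2
    by_cases hmp : m = p
    · rw [if_neg (by rw [hmp]; exact hne)] at h2
      exact one_ne_zero h2
    · rw [if_neg hmp] at h1
      exact one_ne_zero h1
  have hzero (k : ι ⊕ κ) : S.B k i = 0 := by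
    have h1 := DFunLike.congr_fun hpq k
    simp only [p, q, Finsupp.equivFunOnFinite_symm_apply_apply, hcol, neg_neg] at h1
    omega
  have h2u : u = 2 := by
    have h1 := congrArg (eval fun _ => (1 : K)) hm
    simp only [map_add, eval_monomial, one_pow, Finsupp.prod, Finset.prod_const_one, mul_one] at h1
    rw [← h1]
    norm_num
  have hexch : S.exchange i = 2 := by
    simp [exchange, hzero]
    norm_num
  obtain ⟨v, hv⟩ := hu.exists_right_inv
  have h2v : (2 : F) * algebraMap K F v = 1 := by
    have := congrArg (algebraMap K F) hv
    rwa [h2u, map_mul, map_ofNat, map_one] at this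
  have hx : (S.var (Sum.inl i))⁻¹ = (S.mutate i).var (Sum.inl i) * algebraMap K F v := by
    rw [mutate_var_self, hexch, mul_assoc, h2v, mul_one]
  rw [hx]
  exact mul_mem hD (D.algebraMap_mem v)

/-- The exponent of a variable `x_i` with a non-invertible exchange polynomial `P` is bounded in the
divisors of `a`. Up to units of the Laurent ring of the mutated seed, `x_i` is `P`. A large exponent
would make `a` divisible by a large power of `P`, and a large negative exponent the polynomial `g q`. -/
theorem exists_bound_exponent [IsNoetherianRing K] {S : SeedData F ι κ}
    (hS : AlgebraicIndependent K S.var) (hB : IsExchangeMatrix S.B) {i : ι}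
    (hP : (S.exchange i)⁻¹ ∉ (S.mutate i).laurentRing K) {a : F} (ha0 : a ≠ 0)
    (ha : a ∈ (S.mutate i).laurentRing K) {Q : Type*} [Finite Q]
    (g : Q → MvPolynomial (ι ⊕ κ) K) (hg : ∀ q, g q ≠ 0) :
    ∃ N : ℕ, ∀ (q : Q) (r : Kˣ) (e : ι ⊕ κ → ℤ) (b c : F), b * c = a →
      b ∈ (S.mutate i).laurentRing K → c ∈ (S.mutate i).laurentRing K →
      b = algebraMap K F r * (∏ k, S.var k ^ e k) * aeval S.var (g q) →
      e (Sum.inl i) ∈ Finset.Icc (-N : ℤ) N := by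
  set A := (S.mutate i).laurentRing K
  have hnoeth : IsNoetherianRing A := isNoetherianRing_laurentSubalgebra (S.mutate i).var
  have hxA (k : ι ⊕ κ) : S.var k ∈ A := (mem_upperBound.1 (var_mem_upperBound hS hB k)).2 i
  have hyA' : ((S.mutate i).var (Sum.inl i))⁻¹ ∈ A := inv_mem_laurentSubalgebra (S.mutate i).var _
  have hPA : S.exchange i ∈ A := exchange_mem fun k => Or.inr (hxA k)
  have hgA (q : Q) : aeval S.var (g q) ∈ A :=
    (Algebra.adjoin_le (by rintro _ ⟨k, rfl⟩; exact hxA k) :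
      Algebra.adjoin K (Set.range S.var) ≤ A)
      ((Algebra.adjoin_range_eq_range_aeval K S.var).symm ▸ ⟨g q, rfl⟩)
  have hg0 (q : Q) : aeval S.var (g q) ≠ 0 := fun h => hg q (hS (by rw [h, map_zero]))
  obtain ⟨Na, hNa⟩ := exists_bound_of_inv_notMem hPA hP ha ha0
  choose Ng hNg using fun q => exists_bound_of_inv_notMem hPA hP (hgA q) (hg0 q)
  obtain ⟨M, hM⟩ := (Set.finite_range Ng).bddAbove
  refine ⟨max Na M, fun q r e b c hbc hb hc hbe => ?_⟩
  set E := ∏ k ∈ Finset.univ.erase (Sum.inl i), S.var k ^ e k with hE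
  have hEmem : E ∈ A := prod_mem fun k hk => by
    rw [← mutate_var_of_ne S (Finset.ne_of_mem_erase hk)]
    exact zpow_mem_of_mem_of_inv_mem (mem_laurentSubalgebra (S.mutate i).var k)
      (inv_mem_laurentSubalgebra (S.mutate i).var k) _
  have hEinv : E⁻¹ ∈ A := by
    rw [hE, ← Finset.prod_inv_distrib]
    refine prod_mem fun k hk => ?_
    rw [← mutate_var_of_ne S (Finset.ne_of_mem_erase hk), ← zpow_neg]
    exact zpow_mem_of_mem_of_inv_mem (mem_laurentSubalgebra (S.mutate i).var k)
      (inv_mem_laurentSubalgebra (S.mutate i).var k) _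
  have hE0 : E ≠ 0 := Finset.prod_ne_zero_iff.2 fun k _ => zpow_ne_zero _ (hS.ne_zero k)
  have hr0 : algebraMap K F r ≠ 0 := (r.isUnit.map (algebraMap K F)).ne_zero
  have hrinv : (algebraMap K F r)⁻¹ ∈ A := by
    have : (algebraMap K F r)⁻¹ = algebraMap K F ((r⁻¹ : Kˣ) : K) :=
      inv_eq_of_mul_eq_one_right (by rw [← map_mul, Units.mul_inv, map_one])
    rw [this]
    exact A.algebraMap_mem _
  set X := S.var (Sum.inl i)
  have hX0 : X ≠ 0 := hS.ne_zero _
  set Y := (S.mutate i).var (Sum.inl i)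
  have hXY : S.exchange i = X * Y := by
    rw [show Y = X⁻¹ * S.exchange i from mutate_var_self S i, mul_inv_cancel_left₀ hX0]
  rw [← Finset.mul_prod_erase Finset.univ _ (Finset.mem_univ (Sum.inl i)), ← hE] at hbe
  change b = algebraMap K F r * (X ^ e (Sum.inl i) * E) * aeval S.var (g q) at hbe
  rw [Finset.mem_Icc]
  rcases Int.eq_nat_or_neg (e (Sum.inl i)) with ⟨n, hn | hn⟩
  · have hn' : n ≤ Na := by
      refine hNa n ?_
      have : a * (S.exchange i ^ n)⁻¹ =
          algebraMap K F r * E * aeval S.var (g q) * Y⁻¹ ^ n * c := by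
        rw [← hbc, hbe, hn, hXY, zpow_natCast, mul_pow, inv_pow]
        field_simp
      rw [this]
      exact mul_mem (mul_mem (mul_mem (mul_mem (A.algebraMap_mem _) hEmem) (hgA q))
        (pow_mem hyA' n)) hc
    have := le_max_left Na M
    omega
  · have hn' : n ≤ Ng q := by
      refine hNg q n ?_
      have : aeval S.var (g q) * (S.exchange i ^ n)⁻¹ =
          b * (algebraMap K F r)⁻¹ * E⁻¹ * Y⁻¹ ^ n := by
        rw [hbe, hn, hXY, zpow_neg, zpow_natCast, mul_pow, inv_pow]
        field_simp
      rw [this]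
      exact mul_mem (mul_mem (mul_mem hb hrinv) hEinv) (pow_mem hyA' n)
    have h1 : Ng q ≤ M := hM ⟨q, rfl⟩
    have := le_max_right Na M
    omega

/-- Every algebra between the cluster algebra and the upper bound of a seed is a finite factorization
domain. A divisor of `a` is determined, up to units, by a divisor class of the polynomial numerator of
`a` and by its exponents at the variables that are not invertible. -/
theorem isFFDomain_of_le_upperBound [IsDomain K] [IsNoetherianRing K]
    [UniqueFactorizationMonoid K]
    {S : SeedData F ι κ} (hS : AlgebraicIndependent K S.var) (hB : IsExchangeMatrix S.B)
    {D : Subalgebra K F} (hDS : S.clusterAlgebra K ≤ D) (hDU : D ≤ S.upperBound K) :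
    IsFFDomain D := by
  have hvarD (i : ι) : S.var (Sum.inl i) ∈ D :=
    hDS (Algebra.subset_adjoin (Or.inl (Or.inl ⟨S, .refl, i, rfl⟩)))
  have hmutD (i : ι) : (S.mutate i).var (Sum.inl i) ∈ D :=
    hDS (Algebra.subset_adjoin (Or.inl (Or.inl ⟨S.mutate i, .mutate S i .refl, i, rfl⟩)))
  have hfrozD (k : κ) : S.var (Sum.inr k) ∈ D :=
    hDS (Algebra.subset_adjoin (Or.inl (Or.inr ⟨k, rfl⟩)))
  have hfrozD' (k : κ) : (S.var (Sum.inr k))⁻¹ ∈ D :=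
    hDS (Algebra.subset_adjoin (Or.inr ⟨k, rfl⟩))
  refine isFFDomain_of_finite_divisors fun a ha => ?_
  have ha0 : (a : F) ≠ 0 := fun h => ha (Subtype.ext h)
  have hDL {z : F} (hz : z ∈ D) : z ∈ laurentSubalgebra K S.var := (mem_upperBound.1 (hDU hz)).1
  obtain ⟨d, f, hf⟩ := (mem_laurentSubalgebra_iff hS.ne_zero).1 (hDL a.2)
  have hf0 : f ≠ 0 := by
    rintro rfl
    rw [map_zero] at hf
    exact mul_ne_zero ha0 (aeval_monomial_ne_zero hS.ne_zero d) hf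
  let Q := {q : Associates (MvPolynomial (ι ⊕ κ) K) // q ∣ Associates.mk f}
  have hQ : Finite Q :=
    have := UniqueFactorizationMonoid.fintypeSubtypeDvd (Associates.mk f) (Associates.mk_ne_zero.2 hf0)
    Fintype.finite this
  have hout (q : Q) : (Quot.out q.1) ≠ 0 := by
    intro h0
    have h1 : Associates.mk (Quot.out q.1) = q.1 := Associates.quot_out _
    rw [h0, Associates.mk_zero] at h1
    have h2 := q.2
    rw [← h1, zero_dvd_iff] at h2
    exact Associates.mk_ne_zero.2 hf0 h2
  have hbound (i : ι) : ∃ N : ℕ, (S.var (Sum.inl i))⁻¹ ∉ D →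
      ∀ (q : Q) (r : Kˣ) (e : ι ⊕ κ → ℤ) (b c : F), b * c = a → b ∈ D → c ∈ D →
      b = algebraMap K F r * (∏ k, S.var k ^ e k) * aeval S.var (Quot.out q.1) →
      e (Sum.inl i) ∈ Finset.Icc (-N : ℤ) N := by
    rcases inv_exchange_notMem_or_inv_var_mem hS hB i (hmutD i) with hP | hx
    · have hDi {z : F} (hz : z ∈ D) := (mem_upperBound.1 (hDU hz)).2 i
      obtain ⟨N, hN⟩ := exists_bound_exponent hS hB hP ha0 (hDi a.2)
        (fun q : Q => Quot.out q.1) hout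
      exact ⟨N, fun _ q r e b c hbc hb hc => hN q r e b c hbc (hDi hb) (hDi hc)⟩
    · exact ⟨0, fun h => absurd hx h⟩
  choose N hN using hbound
  have hdata (δ : {δ : Associates D | δ ∣ Associates.mk a}) :
      ∃ t : Q × ((i : ι) → Finset.Icc (-N i : ℤ) (N i)), ∃ (b : D) (r : Kˣ) (e : ι ⊕ κ → ℤ),
        Associates.mk b = δ ∧
        (b : F) = algebraMap K F r * (∏ k, S.var k ^ e k) * aeval S.var (Quot.out t.1.1) ∧
        ∀ i, (S.var (Sum.inl i))⁻¹ ∉ D → (t.2 i : ℤ) = e (Sum.inl i) := by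
    obtain ⟨δ, hδ⟩ := δ
    obtain ⟨b, rfl⟩ := Associates.mk_surjective δ
    obtain ⟨c, hc⟩ := Associates.mk_dvd_mk.1 hδ
    have hbc : (b : F) * c = a := (congrArg Subtype.val hc).symm
    obtain ⟨q, r, e, hbe⟩ := exists_eq_mul_aeval_out hS (hDL b.2) (hDL c.2) hbc hf
    classical
    refine ⟨⟨q, fun i => if h : (S.var (Sum.inl i))⁻¹ ∈ D then ⟨0, by simp⟩ else
      ⟨e (Sum.inl i), hN i h q r e b c hbc b.2 c.2 hbe⟩⟩, b, r, e, rfl, hbe, fun i hi => ?_⟩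
    simp only [dif_neg hi]
  choose t b r e hb hbe ht using hdata
  have : Finite {δ : Associates D | δ ∣ Associates.mk a} := by
    refine Finite.of_injective t fun δ δ' hδ => Subtype.ext ?_
    rw [← hb, ← hb δ', Associates.mk_eq_mk_iff_associated]
    -- equal data differ by a unit of `K` and by powers of invertible variables
    have hunit (δ δ') (hδ : t δ = t δ') : ∏ k, S.var k ^ (e δ' k - e δ k) ∈ D := by
      refine prod_mem fun k _ => ?_
      rcases k with i | k
      · by_cases hi : (S.var (Sum.inl i))⁻¹ ∈ D
        · exact zpow_mem_of_mem_of_inv_mem (hvarD i) hi _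
        · rw [← ht δ i hi, ← ht δ' i hi, hδ, sub_self, zpow_zero]
          exact one_mem D
      · exact zpow_mem_of_mem_of_inv_mem (hfrozD k) (hfrozD' k) _
    have hmul (δ δ') (hδ : t δ = t δ') : b δ ∣ b δ' := by
      refine ⟨⟨algebraMap K F ((r δ)⁻¹ * r δ' : Kˣ) * ∏ k, S.var k ^ (e δ' k - e δ k),
        mul_mem (D.algebraMap_mem _) (hunit δ δ' hδ)⟩, Subtype.ext ?_⟩
      change (b δ' : F) = b δ * (algebraMap K F ((r δ)⁻¹ * r δ' : Kˣ) * _)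
      have h1 : ∏ k, S.var k ^ e δ' k =
          (∏ k, S.var k ^ e δ k) * ∏ k, S.var k ^ (e δ' k - e δ k) := by
        rw [← Finset.prod_mul_distrib]
        refine Finset.prod_congr rfl fun k _ => ?_
        rw [← zpow_add₀ (hS.ne_zero k), add_sub_cancel]
      have h2 : algebraMap K F (r δ') =
          algebraMap K F (r δ) * algebraMap K F ((r δ)⁻¹ * r δ' : Kˣ) := by
        rw [← map_mul, ← Units.val_mul, mul_inv_cancel_left]
      rw [hbe δ', hbe δ, ← hδ, h1, h2]
      ring
    exact associated_of_dvd_dvd (hmul δ δ' hδ) (hmul δ' δ hδ.symm)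
  exact Set.toFinite _

end SeedData

theorem IsClusterGroundRing.isPrincipalIdealRing {K : Type*} [CommRing K]
    (hK : IsClusterGroundRing K) : IsDomain K ∧ CharZero K ∧ IsPrincipalIdealRing K := by
  rcases hK with ⟨hfield, hchar⟩ | ⟨⟨φ⟩⟩
  · exact ⟨hfield.isDomain, hchar, hfield.isPrincipalIdealRing⟩
  · exact ⟨φ.toMulEquiv.isDomain ℤ,
      charZero_of_injective_ringHom (f := φ.symm.toRingHom) φ.symm.injective,
      IsPrincipalIdealRing.of_surjective φ.symm.toRingHom φ.symm.surjective⟩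

theorem theorem2p5 {K F : Type*} [CommRing K] [Field F] [Algebra K F]
    (hK : IsClusterGroundRing K) (n m : ℕ) (S : SeedData F (Fin n) (Fin m)) (hS : S.IsSeed K) :
    (IsFFDomain (S.clusterAlgebra K) ∧ IsBFDomain (S.clusterAlgebra K) ∧
      IsAtomicDomain (S.clusterAlgebra K)) ∧
    (IsFFDomain (S.upperClusterAlgebra K) ∧ IsBFDomain (S.upperClusterAlgebra K) ∧
      IsAtomicDomain (S.upperClusterAlgebra K)) := by
  obtain ⟨_, _, _⟩ := hK.isPrincipalIdealRing
  have hle := SeedData.clusterAlgebra_le_upperClusterAlgebra hS.algebraicIndependent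
    hS.isExchangeMatrix
  have hU := S.upperClusterAlgebra_le_upperBound (K := K)
  have h1 := SeedData.isFFDomain_of_le_upperBound hS.algebraicIndependent hS.isExchangeMatrix
    le_rfl (hle.trans hU)
  have h2 := SeedData.isFFDomain_of_le_upperBound hS.algebraicIndependent hS.isExchangeMatrix
    hle hU
  exact ⟨⟨h1, h1.isBFDomain, h1.isAtomicDomain⟩, ⟨h2, h2.isBFDomain, h2.isAtomicDomain⟩⟩
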